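/- Let $(\mathbb{H}_{\mathrm{pr}}, d_{\mathbb{H}_{\mathrm{pr}}})$ be the metric space of triples $(F,d,G)$, where $(F,d)$ is a non-empty compact metric space and $G:F\to\mathbb{R}$ is continuous, with two triples identified when a surjective isometry carries one function to the other, and with $$d_{\mathbb{H}_{\mathrm{pr}}}\bigl((F_1,d_1,G_1),(F_2,d_2,G_2)\bigr)=\inf_{Z,f_1,f_2,\mathcal{C}}\ \sup_{(x_1,x_2)\in\mathcal{C}}\ d^Z(f_1(x_1),f_2(x_2))\vee|G_1(x_1)-G_2(x_2)|,$$ where the infimum is over all compact metric spaces $(Z,d^Z)$, all distance-preserving maps $f_i:F_i\to Z$ and all correspondences $\mathcal{C}\subseteq F_1\times F_2$. (A correspondence between $A$ and $B$ is a set $\mathcal{C}\subseteq A\times B$ whose projections to $A$ and to $B$ are both onto.) For non-empty compact metric spaces $(F_i,d_i)$ and functions $\Sigma_i: F_i\times F_i\to\mathbb{R}$, $i=1,2$, put likewise $$d_{\mathbb{H}_{\mathrm{cov}}}\bigl((F_1,d_1,\Sigma_1),(F_2,d_2,\Sigma_2)\bigr)=\inf_{Z,f_1,f_2,\mathcal{C}}\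 \sup_{((x_1,y_1),(x_2,y_2))\in\mathcal{C}} d^Z(f_1(x_1),f_2(x_2))\vee d^Z(f_1(y_1),f_2(y_2))\vee|\Sigma_1(x_1,y_1)-\Sigma_2(x_2,y_2)|,$$ where $\mathcal{C}$ now ranges over the correspondences between $F_1\times F_1$ and $F_2\times F_2$. For a centred (mean zero) real Gaussian process $G=(G(x))_{x\in F}$ on a non-empty index set $F$, let $\Sigma_G(x,y)=E[G(x)G(y)]$ and $d_G(x,y)=\bigl(E[(G(x)-G(y))^2]\bigr)^{1/2}$. Let $\mathfrak{G}^m_c$ be the class of such $G$ for which $d_G$ is a metric and $(F,d_G)$ is compact, and write $N_{d_G}(F,\varepsilon)$ for the least cardinality of a set $A\subseteq F$ such that every $x\in F$ satisfies $d_G(x,a)\le\varepsilon$ for some $a\in A$. Let $\check{\mathfrak{G}}^m_c$ be the class of $G\in\mathfrak{G}^m_c$ such that $\sum_{l\ge 0}N_{d_G}(F,2^{-l})^2\exp(-2^{2\alpha l})<\infty$ for some $\alpha\in(0,1)$. **Theorem.** Let $G_n=(G_n(x))_{x\in F_n}$, $n\in\mathbb{N}$, belong to $\check{\mathfrak{G}}^m_c$,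 and let $G=(G(x))_{x\in F}$ belong to $\mathfrak{G}^m_c$, where the processes may be defined on different probability spaces $(\Omega_n,P_n)$ and $(\Omega,P)$. Suppose that 1. $d_{\mathbb{H}_{\mathrm{cov}}}\bigl((F_n,d_{G_n},\Sigma_{G_n}),(F,d_G,\Sigma_G)\bigr)\to 0$ as $n\to\infty$; 2. there is an $\alpha\in(0,1)$ such that $$\lim_{k\to\infty}\limsup_{n\to\infty}\sum_{l\ge k}N_{d_{G_n}}(F_n,2^{-l})^2\exp(-2^{2\alpha l})=0.$$ Then $G\in\check{\mathfrak{G}}^m_c$; the processes $G_n$ and $G$ have versions with almost surely continuous paths on $(F_n,d_{G_n})$ and $(F,d_G)$; and, for every choice of such versions, $(F_n,d_{G_n},G_n)$ and $(F,d_G,G)$ are random elements of $\mathbb{H}_{\mathrm{pr}}$ (defined almost surely, and measurable up to null sets), and the law of $(F_n,d_{G_n},G_n)$ under $P_n$ converges weakly to the law of $(F,d_G,G)$ under $P$ as probability measures on $(\mathbb{H}_{\mathrm{pr}},d_{\mathbb{H}_{\mathrm{pr}}})$. -/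

import Mathlib

open MeasureTheory ProbabilityTheory Filter Topology
open scoped ENNReal

universe u v w

noncomputable section

namespace GaussConv

/-! ### Correspondences and the two Gromov-Hausdorff-type distances -/

/-- A correspondence between `A` and `B`: a relation all of whose points are matched,
on both sides. -/
def IsCorrespondence {A B : Type*} (C : Set (A × B)) : Prop :=
  (∀ a, ∃ b, (a, b) ∈ C) ∧ ∀ b, ∃ a, (a, b) ∈ C

/-- The distance of `ℍ_cov` between the triples `(F₁, d₁, S₁)` and `(F₂, d₂, S₂)`, where `Sᵢ` is a
real-valued function on `Fᵢ × Fᵢ`: the infimum runs over all compact metric spaces `Z`, all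
distance-preserving maps `fᵢ : Fᵢ → Z` and all correspondences between `F₁ × F₁` and `F₂ × F₂`. -/
def covEDist {F₁ F₂ : Type u} [MetricSpace F₁] [MetricSpace F₂]
    (S₁ : F₁ → F₁ → ℝ) (S₂ : F₂ → F₂ → ℝ) : ℝ≥0∞ :=
  ⨅ (Z : Type u) (_ : MetricSpace Z) (_ : CompactSpace Z) (f₁ : F₁ → Z) (f₂ : F₂ → Z)
    (_ : Isometry f₁) (_ : Isometry f₂) (C : Set ((F₁ × F₁) × (F₂ × F₂)))
    (_ : IsCorrespondence C),
    ⨆ p ∈ C, max (max (edist (f₁ p.1.1) (f₂ p.2.1)) (edist (f₁ p.1.2) (f₂ p.2.2)))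
      (edist (S₁ p.1.1 p.1.2) (S₂ p.2.1 p.2.2))

/-- A triple `(F, d, G)`: a nonempty compact metric space with a continuous real function on it. -/
structure PrTriple : Type (u + 1) where
  carrier : Type u
  [metric : MetricSpace carrier]
  [compact : CompactSpace carrier]
  [nonempty : Nonempty carrier]
  fn : C(carrier, ℝ)

attribute [instance] PrTriple.metric PrTriple.compact PrTriple.nonempty

/-- The distance of `ℍ_pr` between two triples: the infimum runs over all compact metric spaces
`Z`, all distance-preserving maps into `Z` and all correspondences. -/
def prEDist (X Y : PrTriple.{u}) : ℝ≥0∞ :=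
  ⨅ (Z : Type u) (_ : MetricSpace Z) (_ : CompactSpace Z) (f₁ : X.carrier → Z) (f₂ : Y.carrier → Z)
    (_ : Isometry f₁) (_ : Isometry f₂) (C : Set (X.carrier × Y.carrier))
    (_ : IsCorrespondence C),
    ⨆ p ∈ C, max (edist (f₁ p.1) (f₂ p.2)) (edist (X.fn p.1) (Y.fn p.2))

/-- Two triples are identified when a surjective isometry carries one function to the other. -/
def PrTriple.Iso (X Y : PrTriple.{u}) : Prop :=
  ∃ e : X.carrier ≃ᵢ Y.carrier, ∀ x, Y.fn (e x) = X.fn x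

theorem PrTriple.Iso.symm {X Y : PrTriple.{u}} (h : X.Iso Y) : Y.Iso X := by
  obtain ⟨e, he⟩ := h
  exact ⟨e.symm, fun y => by rw [← he]; simp⟩

theorem PrTriple.iso_equivalence : Equivalence PrTriple.Iso.{u} where
  refl X := ⟨IsometryEquiv.refl _, fun _ => rfl⟩
  symm h := h.symm
  trans := by
    rintro X Y W ⟨e, he⟩ ⟨e', he'⟩
    exact ⟨e.trans e', fun x => by simp [he, he']⟩

instance PrTriple.setoid : Setoid PrTriple.{u} := ⟨PrTriple.Iso, PrTriple.iso_equivalence⟩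

theorem prEDist_le {X Y : PrTriple.{u}} {Z : Type u} [MetricSpace Z] [CompactSpace Z]
    {f₁ : X.carrier → Z} {f₂ : Y.carrier → Z} (h₁ : Isometry f₁) (h₂ : Isometry f₂)
    {C : Set (X.carrier × Y.carrier)} (hC : IsCorrespondence C) {r : ℝ≥0∞}
    (h : ∀ p ∈ C, edist (f₁ p.1) (f₂ p.2) ≤ r ∧ edist (X.fn p.1) (Y.fn p.2) ≤ r) :
    prEDist X Y ≤ r := by
  unfold prEDist
  refine iInf_le_of_le Z <| iInf_le_of_le ‹_› <| iInf_le_of_le ‹_› <| iInf_le_of_le f₁ <|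
    iInf_le_of_le f₂ <| iInf_le_of_le h₁ <| iInf_le_of_le h₂ <| iInf_le_of_le C <|
    iInf_le_of_le hC ?_
  exact iSup₂_le fun p hp => max_le (h p hp).1 (h p hp).2

theorem exists_of_prEDist_lt {X Y : PrTriple.{u}} {r : ℝ≥0∞} (h : prEDist X Y < r) :
    ∃ (Z : Type u) (_ : MetricSpace Z) (_ : CompactSpace Z) (f₁ : X.carrier → Z)
      (f₂ : Y.carrier → Z) (_ : Isometry f₁) (_ : Isometry f₂) (C : Set (X.carrier × Y.carrier))
      (_ : IsCorrespondence C),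
      ∀ p ∈ C, edist (f₁ p.1) (f₂ p.2) ≤ r ∧ edist (X.fn p.1) (Y.fn p.2) ≤ r := by
  simp only [prEDist, iInf_lt_iff] at h
  obtain ⟨Z, i, j, f₁, f₂, h₁, h₂, C, hC, h⟩ := h
  refine ⟨Z, i, j, f₁, f₂, h₁, h₂, C, hC, fun p hp => ?_⟩
  have := (le_iSup₂ (f := fun p (_ : p ∈ C) =>
    max (edist (f₁ p.1) (f₂ p.2)) (edist (X.fn p.1) (Y.fn p.2))) p hp).trans h.le
  exact ⟨(le_max_left _ _).trans this, (le_max_right _ _).trans this⟩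

theorem prEDist_eq_zero_of_iso {X Y : PrTriple.{u}} (h : X.Iso Y) : prEDist X Y = 0 := by
  obtain ⟨e, he⟩ := h
  refine le_antisymm (prEDist_le (Z := Y.carrier) (f₁ := e) (f₂ := id) e.isometry isometry_id
    (C := {p | e p.1 = p.2}) ⟨fun a => ⟨e a, rfl⟩, fun b => ⟨e.symm b, by simp⟩⟩ ?_) zero_le
  rintro ⟨x, y⟩ (rfl : e x = y)
  simp [he]

theorem prEDist_comm_le (X Y : PrTriple.{u}) : prEDist Y X ≤ prEDist X Y := by
  refine le_of_forall_gt fun r hr => ?_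
  obtain ⟨s, hs, hsr⟩ := exists_between hr
  obtain ⟨Z, _, _, f₁, f₂, h₁, h₂, C, hC, h⟩ := exists_of_prEDist_lt hs
  refine lt_of_le_of_lt (prEDist_le h₂ h₁ (C := {p | p.swap ∈ C}) ⟨hC.2, hC.1⟩ ?_) hsr
  intro p hp
  have := h _ hp
  exact ⟨by rw [edist_comm]; exact this.1, by rw [edist_comm]; exact this.2⟩

theorem prEDist_comm (X Y : PrTriple.{u}) : prEDist X Y = prEDist Y X :=
  le_antisymm (prEDist_comm_le _ _) (prEDist_comm_le _ _)

theorem prEDist_triangle (X Y W : PrTriple.{u}) :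
    prEDist X W ≤ prEDist X Y + prEDist Y W := by
  refine ENNReal.le_of_forall_pos_le_add fun ε hε hfin => ?_
  have hε' : ((ε : ℝ≥0∞) / 2) ≠ 0 := by
    simp [hε.ne']
  have hXY : prEDist X Y < prEDist X Y + ε / 2 :=
    ENNReal.lt_add_right (ne_top_of_le_ne_top hfin.ne le_self_add) hε'
  have hYW : prEDist Y W < prEDist Y W + ε / 2 :=
    ENNReal.lt_add_right (ne_top_of_le_ne_top hfin.ne le_add_self) hε'
  obtain ⟨Z₁, _, _, f₁, f₂, h₁, h₂, C, hC, h⟩ := exists_of_prEDist_lt hXY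
  obtain ⟨Z₂, _, _, g₁, g₂, k₁, k₂, D, hD, k⟩ := exists_of_prEDist_lt hYW
  have hcomm := Metric.toGlue_commute h₂ k₁
  have hL := Metric.toGlueL_isometry h₂ k₁
  have hR := Metric.toGlueR_isometry h₂ k₁
  have : CompactSpace (Metric.GlueSpace h₂ k₁) := by
    refine ⟨?_⟩
    have huniv : (Set.univ : Set (Metric.GlueSpace h₂ k₁)) =
        Set.range (Metric.toGlueL h₂ k₁) ∪ Set.range (Metric.toGlueR h₂ k₁) := by
      refine (Set.eq_univ_of_forall fun z => ?_).symm
      obtain ⟨s, rfl⟩ := Quotient.exists_rep z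
      cases s with
      | inl a => exact Or.inl ⟨a, rfl⟩
      | inr b => exact Or.inr ⟨b, rfl⟩
    rw [huniv]
    exact (isCompact_range hL.continuous).union (isCompact_range hR.continuous)
  have hsum : prEDist X Y + ε / 2 + (prEDist Y W + ε / 2) = prEDist X Y + prEDist Y W + ε := by
    rw [add_add_add_comm, ENNReal.add_halves]
  rw [← hsum]
  refine prEDist_le (hL.comp h₁) (hR.comp k₂) (C := {p | ∃ y, (p.1, y) ∈ C ∧ (y, p.2) ∈ D})
    ⟨fun a => ?_, fun b => ?_⟩ ?_
  · obtain ⟨y, hy⟩ := hC.1 a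
    obtain ⟨b, hb⟩ := hD.1 y
    exact ⟨b, y, hy, hb⟩
  · obtain ⟨y, hy⟩ := hD.2 b
    obtain ⟨a, ha⟩ := hC.2 y
    exact ⟨a, y, ha, hy⟩
  · rintro ⟨x, w⟩ ⟨y, hxy, hyw⟩
    refine ⟨(edist_triangle _ (Metric.toGlueL h₂ k₁ (f₂ y)) _).trans (add_le_add ?_ ?_),
      (edist_triangle _ (Y.fn y) _).trans (add_le_add (h _ hxy).2 (k _ hyw).2)⟩
    · exact (hL.edist_eq _ _).trans_le (h _ hxy).1
    · have : Metric.toGlueL h₂ k₁ (f₂ y) = Metric.toGlueR h₂ k₁ (g₁ y) := congrFun hcomm y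
      rw [this]
      exact (hR.edist_eq _ _).trans_le (k _ hyw).1

theorem prEDist_ne_top (X Y : PrTriple.{u}) : prEDist X Y ≠ ∞ := by
  let Z := GromovHausdorff.OptimalGHCoupling X.carrier Y.carrier
  have hX := isCompact_range X.fn.continuous
  have hY := isCompact_range Y.fn.continuous
  have hb : Metric.ediam (Set.range X.fn ∪ Set.range Y.fn) ≠ ∞ :=
    (hX.union hY).isBounded.ediam_ne_top
  have hZ : Metric.ediam (Set.univ : Set Z) ≠ ∞ := isCompact_univ.isBounded.ediam_ne_top
  refine ne_top_of_le_ne_top (max_ne_top hZ hb) (prEDist_le (Z := Z)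
    (GromovHausdorff.isometry_optimalGHInjl X.carrier Y.carrier)
    (GromovHausdorff.isometry_optimalGHInjr X.carrier Y.carrier) (C := Set.univ)
    ⟨fun _ => ⟨Classical.arbitrary _, trivial⟩, fun _ => ⟨Classical.arbitrary _, trivial⟩⟩
    fun p _ => ⟨?_, ?_⟩)
  · exact (Metric.edist_le_ediam_of_mem (Set.mem_univ _) (Set.mem_univ _)).trans (le_max_left _ _)
  · exact (Metric.edist_le_ediam_of_mem (Set.mem_union_left _ (Set.mem_range_self p.1))
      (Set.mem_union_right _ (Set.mem_range_self p.2))).trans (le_max_right _ _)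

theorem iso_of_prEDist_eq_zero {X Y : PrTriple.{u}} (h : prEDist X Y = 0) : X.Iso Y := by
  -- near-optimal correspondences give almost isometric maps, and ultralimits of these are isometries
  have hpos : ∀ n : ℕ, (0 : ℝ) < 1 / ((n : ℝ) + 1) := fun n => Nat.one_div_pos_of_nat
  have key : ∀ n : ℕ, ∃ (φ : X.carrier → Y.carrier) (ψ : Y.carrier → X.carrier),
      (∀ x x', |dist (φ x) (φ x') - dist x x'| ≤ 2 * (1 / ((n : ℝ) + 1))) ∧
      (∀ x, |X.fn x - Y.fn (φ x)| ≤ 1 / ((n : ℝ) + 1)) ∧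
      (∀ y x, dist (φ x) y ≤ dist x (ψ y) + 2 * (1 / ((n : ℝ) + 1))) := by
    intro n
    have hn : prEDist X Y < ENNReal.ofReal (1 / ((n : ℝ) + 1)) := by
      rw [h]; exact ENNReal.ofReal_pos.2 (hpos n)
    obtain ⟨Z, _, _, f, g, hf, hg, C, hC, hd⟩ := exists_of_prEDist_lt hn
    choose φ hφ using hC.1
    choose ψ hψ using hC.2
    have hd1 : ∀ x y, (x, y) ∈ C → dist (f x) (g y) ≤ 1 / ((n : ℝ) + 1) := fun x y hxy => by
      have := (hd _ hxy).1
      rwa [edist_le_ofReal (hpos n).le] at this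
    have hd2 : ∀ x y, (x, y) ∈ C → dist (X.fn x) (Y.fn y) ≤ 1 / ((n : ℝ) + 1) := fun x y hxy => by
      have := (hd _ hxy).2
      rwa [edist_le_ofReal (hpos n).le] at this
    have tri : ∀ x y x' y', (x, y) ∈ C → (x', y') ∈ C →
        |dist y y' - dist x x'| ≤ 2 * (1 / ((n : ℝ) + 1)) := by
      intro x y x' y' h1 h2
      have e1 := hd1 _ _ h1
      have e2 := hd1 _ _ h2
      rw [← hf.dist_eq x x', ← hg.dist_eq y y', abs_le]
      have a1 := dist_triangle4 (f x) (g y) (g y') (f x')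
      have a2 := dist_triangle4 (g y) (f x) (f x') (g y')
      rw [dist_comm (g y') (f x')] at a1
      rw [dist_comm (g y) (f x)] at a2
      constructor <;> linarith
    refine ⟨φ, ψ, fun x x' => tri _ _ _ _ (hφ x) (hφ x'), fun x => ?_, fun y x => ?_⟩
    · rw [← Real.dist_eq]; exact hd2 _ _ (hφ x)
    · have := (abs_le.1 (tri _ _ _ _ (hφ x) (hψ y))).2
      linarith
  choose φ ψ h1 h2 h3 using key
  let U : Ultrafilter ℕ := hyperfilter ℕ
  have hU : (U : Filter ℕ) ≤ atTop := Nat.hyperfilter_le_atTop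
  have hlim0 : Tendsto (fun n : ℕ => 1 / ((n : ℝ) + 1)) U (𝓝 0) :=
    tendsto_one_div_add_atTop_nhds_zero_nat.mono_left hU
  have hlim2 : Tendsto (fun n : ℕ => 2 * (1 / ((n : ℝ) + 1))) U (𝓝 0) := by
    simpa using hlim0.const_mul 2
  have exX : ∀ a : ℕ → X.carrier, ∃ x, Tendsto a U (𝓝 x) := fun a =>
    ⟨(U.map a).lim, Ultrafilter.le_nhds_lim _⟩
  have exY : ∀ a : ℕ → Y.carrier, ∃ y, Tendsto a U (𝓝 y) := fun a =>
    ⟨(U.map a).lim, Ultrafilter.le_nhds_lim _⟩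
  choose Φ hΦ using fun x => exY fun n => φ n x
  choose Ψ hΨ using fun y => exX fun n => ψ n y
  have hiso : Isometry Φ := by
    refine Isometry.of_dist_eq fun x x' => ?_
    have l1 : Tendsto (fun n => dist (φ n x) (φ n x') - dist x x') U
        (𝓝 (dist (Φ x) (Φ x') - dist x x')) := ((hΦ x).dist (hΦ x')).sub_const _
    have l2 : Tendsto (fun n => dist (φ n x) (φ n x') - dist x x') U (𝓝 0) :=
      squeeze_zero_norm (fun n => by rw [Real.norm_eq_abs]; exact h1 n x x') hlim2
    have := tendsto_nhds_unique l1 l2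
    linarith
  have hsurj : Function.Surjective Φ := by
    intro y
    refine ⟨Ψ y, ?_⟩
    have l1 : Tendsto (fun n => dist (φ n (Ψ y)) y) U (𝓝 (dist (Φ (Ψ y)) y)) :=
      (hΦ (Ψ y)).dist tendsto_const_nhds
    have l2 : Tendsto (fun n => dist (Ψ y) (ψ n y) + 2 * (1 / ((n : ℝ) + 1))) U (𝓝 0) := by
      have := ((tendsto_const_nhds (x := Ψ y)).dist (hΨ y)).add hlim2
      simpa using this
    have := le_of_tendsto_of_tendsto' l1 l2 fun n => h3 n y (Ψ y)
    exact dist_le_zero.1 this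
  refine ⟨IsometryEquiv.mk (Equiv.ofBijective Φ ⟨hiso.injective, hsurj⟩) hiso, fun x => ?_⟩
  change Y.fn (Φ x) = X.fn x
  have l1 : Tendsto (fun n => X.fn x - Y.fn (φ n x)) U (𝓝 (X.fn x - Y.fn (Φ x))) :=
    tendsto_const_nhds.sub ((Y.fn.continuous.tendsto _).comp (hΦ x))
  have l2 : Tendsto (fun n => X.fn x - Y.fn (φ n x)) U (𝓝 0) :=
    squeeze_zero_norm (fun n => by rw [Real.norm_eq_abs]; exact h2 n x) hlim0
  have := tendsto_nhds_unique l1 l2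
  linarith

/-- The space `ℍ_pr`: triples `(F, d, G)` up to isometries that respect the functions. -/
def HPr : Type (u + 1) := Quotient PrTriple.setoid.{u}

theorem prEDist_congr {X Y X' Y' : PrTriple.{u}} (hX : X.Iso X') (hY : Y.Iso Y') :
    prEDist X Y = prEDist X' Y' := by
  have aux : ∀ {X Y X' Y' : PrTriple.{u}}, X.Iso X' → Y.Iso Y' →
      prEDist X Y ≤ prEDist X' Y' := by
    intro X Y X' Y' hX hY
    have h1 := prEDist_triangle X X' Y
    have h2 := prEDist_triangle X' Y' Y
    rw [prEDist_eq_zero_of_iso hX, zero_add] at h1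
    rw [prEDist_eq_zero_of_iso hY.symm, add_zero] at h2
    exact h1.trans h2
  exact le_antisymm (aux hX hY) (aux hX.symm hY.symm)

abbrev HPr.emetricSpace : EMetricSpace HPr.{u} where
  edist := Quotient.lift₂ prEDist fun _ _ _ _ => prEDist_congr
  edist_self := by
    rintro ⟨X⟩
    exact prEDist_eq_zero_of_iso (PrTriple.iso_equivalence.refl X)
  edist_comm := by
    rintro ⟨X⟩ ⟨Y⟩
    exact prEDist_comm X Y
  edist_triangle := by
    rintro ⟨X⟩ ⟨Y⟩ ⟨W⟩
    exact prEDist_triangle X Y W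
  eq_of_edist_eq_zero := by
    rintro ⟨X⟩ ⟨Y⟩ h
    exact Quotient.sound (iso_of_prEDist_eq_zero h)

/-- `ℍ_pr` with the (finite) distance `prEDist` is a metric space. -/
instance HPr.metricSpace : MetricSpace HPr.{u} :=
  @EMetricSpace.toMetricSpace _ HPr.emetricSpace (by rintro ⟨X⟩ ⟨Y⟩; exact prEDist_ne_top X Y)

instance HPr.measurableSpace : MeasurableSpace HPr.{u} := borel _

instance HPr.borelSpace : BorelSpace HPr.{u} := ⟨rfl⟩

/-! ### Gaussian processes -/

/-- `G = (G x)_{x ∈ F}` is a centred Gaussian process on `(Ω, P)` and the metric of `F` is its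
natural metric `d_G(x, y) = (E (G x - G y)²)^{1/2}`. -/
structure IsCentredGaussian {F : Type u} [MetricSpace F] {Ω : Type v} [MeasurableSpace Ω]
    (G : F → Ω → ℝ) (P : Measure Ω) : Prop where
  gaussian : IsGaussianProcess G P
  centred : ∀ x, ∫ ω, G x ω ∂P = 0
  dist_eq : ∀ x y, dist x y = Real.sqrt (∫ ω, (G x ω - G y ω) ^ 2 ∂P)

/-- The covariance function `Σ_G`. -/
def covFn {F : Type u} {Ω : Type v} [MeasurableSpace Ω] (G : F → Ω → ℝ) (P : Measure Ω)
    (x y : F) : ℝ :=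
  cov[G x, G y; P]

/-- The tail `∑_{l ≥ k} N(F, 2^{-l})² exp(-2^{2αl})`, where `N(F, ε)` is the least cardinality of a
set whose closed `ε`-balls cover `F`. -/
def entropyTail (F : Type u) [MetricSpace F] (α : ℝ) (k : ℕ) : ℝ≥0∞ :=
  ∑' l : Set.Ici k, ((Metric.coveringNumber ((2 : NNReal)⁻¹ ^ (l : ℕ)) (Set.univ : Set F) : ℕ∞) :
    ℝ≥0∞) ^ 2 * ENNReal.ofReal (Real.exp (-(2 : ℝ) ^ (2 * α * ((l : ℕ) : ℝ))))

/-- The summability condition on the metric entropy. -/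
def EntropySummable (F : Type u) [MetricSpace F] : Prop :=
  ∃ α ∈ Set.Ioo (0 : ℝ) 1, entropyTail F α 0 < ∞

/-- `G'` is a version of `G` with almost surely continuous paths. -/
structure IsContinuousVersion {F : Type u} [MetricSpace F] {Ω : Type v} [MeasurableSpace Ω]
    (G G' : F → Ω → ℝ) (P : Measure Ω) : Prop where
  version : ∀ x, G' x =ᵐ[P] G x
  continuous : ∀ᵐ ω ∂P, Continuous fun x => G' x ω

open Classical in
/-- The element `(F, d, g)` of `ℍ_pr` given by a path `g`; a discontinuous path (which has
probability zero where this is used) is replaced by the zero function. -/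
def pathTriple (F : Type u) [MetricSpace F] [CompactSpace F] [Nonempty F] (g : F → ℝ) :
    HPr.{u} :=
  if h : Continuous g then Quotient.mk _ ⟨F, ⟨g, h⟩⟩ else Quotient.mk _ ⟨F, 0⟩

end GaussConv

end

namespace GaussConv

/-! ### Distances between paths in `ℍ_pr` -/

section PathTriple

variable {F F₁ F₂ : Type u} [MetricSpace F] [CompactSpace F] [Nonempty F]
  [MetricSpace F₁] [CompactSpace F₁] [Nonempty F₁] [MetricSpace F₂] [CompactSpace F₂] [Nonempty F₂]

/-! Weak convergence is obtained from finite marginals and an approximation by finite nets that is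
uniform along the sequence (`tendstoInDistribution_of_approx`).

Marginals: a small `covEDist` gives almost isometric maps `q n` from `F₀` to `F n`. Since the
correspondence matches pairs, it only says that the variance at `y` is close to the covariance of
two nearby points of `F n`. Cauchy–Schwarz turns this into convergence of variances
(`abs_covFn_self_sub_le`), and polarization with the distances gives all covariances
(`tendsto_covFn_toLeft`). By Lévy's theorem the Gaussian vectors indexed by a finite `B ⊆ F₀`
converge in law. Placed on the fixed finite metric space `B`, they are converging random elements of
`ℍ_pr`.

Uniformity: passing from `B` to the whole of `F n` costs a modulus of continuity. Chaining along
`2⁻ˡ`-nets shows that, outside an event of probability at most `8 * entropyTail F α k`, a path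
oscillates by at most `3 * tailBound α k` over distances `2 * 2⁻ᵏ` (`measure_not_modulus_le`). As
`tailBound` depends on `α` alone and tends to `0`, condition 2 makes the error uniform.

The same chaining, with Borel–Cantelli, produces continuous versions. For `F₀` the entropy condition
is inherited from the `F n` by comparing covering numbers, at the price of a larger exponent
(`entropySummable_of_covCoupling`). -/

theorem pathTriple_of_continuous {g : F → ℝ} (h : Continuous g) :
    pathTriple F g = (Quotient.mk PrTriple.setoid ⟨F, ⟨g, h⟩⟩ : HPr) :=
  dif_pos h

theorem dist_pathTriple_le {g₁ : F₁ → ℝ} {g₂ : F₂ → ℝ} (hg₁ : Continuous g₁) (hg₂ : Continuous g₂)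
    {Z : Type u} [MetricSpace Z] [CompactSpace Z] {f₁ : F₁ → Z} {f₂ : F₂ → Z}
    (h₁ : Isometry f₁) (h₂ : Isometry f₂) {C : Set (F₁ × F₂)} (hC : IsCorrespondence C)
    {r : ℝ} (hr : 0 ≤ r)
    (h : ∀ x y, (x, y) ∈ C → dist (f₁ x) (f₂ y) ≤ r ∧ |g₁ x - g₂ y| ≤ r) :
    dist (pathTriple F₁ g₁) (pathTriple F₂ g₂) ≤ r := by
  refine (edist_le_ofReal hr).1 ?_
  rw [pathTriple_of_continuous hg₁, pathTriple_of_continuous hg₂]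
  change prEDist _ _ ≤ _
  refine prEDist_le h₁ h₂ hC fun p hp => ?_
  rw [edist_le_ofReal hr, edist_le_ofReal hr]
  exact h _ _ hp

/-- The diagonal correspondence makes the map 1-Lipschitz. It carries convergence in law of finite
marginals over to `ℍ_pr` and gives measurability of the discretized paths. -/
theorem continuous_pathTriple_of_finite (B : Type u) [MetricSpace B] [Finite B] [Nonempty B] :
    Continuous fun v : B → ℝ => pathTriple B v := by
  have := Fintype.ofFinite B
  refine (LipschitzWith.mk_one fun v w => ?_).continuous
  refine dist_pathTriple_le continuous_of_discreteTopology continuous_of_discreteTopology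
    (f₁ := id) (f₂ := id) isometry_id isometry_id (C := {p | p.1 = p.2})
    ⟨fun a => ⟨a, rfl⟩, fun b => ⟨b, rfl⟩⟩ dist_nonneg ?_
  rintro x y (rfl : x = y)
  exact ⟨by simp, dist_le_pi_dist v w x⟩

theorem dist_pathTriple_net_le {g : F → ℝ} (hg : Continuous g) (B : Finset F) [Nonempty B]
    {δ r : ℝ} (hδ : 0 ≤ δ) (hB : ∀ x, ∃ b ∈ B, dist x b ≤ δ) (hδr : δ ≤ r)
    (h : ∀ x y, dist x y ≤ δ → |g x - g y| ≤ r) :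
    dist (pathTriple B fun b => g b) (pathTriple F g) ≤ r := by
  refine dist_pathTriple_le continuous_of_discreteTopology hg (f₁ := Subtype.val) (f₂ := id)
    isometry_subtype_coe isometry_id (C := {p | dist (p.1 : F) p.2 ≤ δ})
    ⟨fun a => ⟨a, by simpa using hδ⟩, fun x => ?_⟩ (hδ.trans hδr)
    fun x y hxy => ⟨le_trans hxy hδr, h _ _ hxy⟩
  obtain ⟨b, hb, hxb⟩ := hB x
  exact ⟨⟨b, hb⟩, by simpa [dist_comm] using hxb⟩

theorem exists_finset_net {δ : ℝ} (hδ : 0 < δ) :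
    ∃ B : Finset F, Nonempty B ∧ ∀ x, ∃ b ∈ B, dist x b ≤ δ := by
  obtain ⟨t, -, ht, hcov⟩ := (isCompact_univ (X := F)).finite_cover_balls hδ
  have key : ∀ x, ∃ b ∈ ht.toFinset, dist x b ≤ δ := fun x => by
    obtain ⟨b, hb, hxb⟩ := Set.mem_iUnion₂.1 (hcov (Set.mem_univ x))
    exact ⟨b, ht.mem_toFinset.2 hb, (Metric.mem_ball.1 hxb).le⟩
  obtain ⟨b, hb, -⟩ := key (Classical.arbitrary F)
  exact ⟨ht.toFinset, ⟨b, hb⟩, key⟩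

theorem tendsto_pathTriple_net {g : F → ℝ} (hg : Continuous g) {B : ℕ → Finset F}
    [∀ k, Nonempty (B k)] {δ : ℕ → ℝ} (hδ : ∀ k, 0 ≤ δ k) (hδ0 : Tendsto δ atTop (𝓝 0))
    (hB : ∀ k x, ∃ b ∈ B k, dist x b ≤ δ k) :
    Tendsto (fun k => pathTriple (B k) fun b => g b) atTop (𝓝 (pathTriple F g)) := by
  rw [tendsto_iff_dist_tendsto_zero]
  refine Metric.tendsto_atTop.2 fun ε hε => ?_
  obtain ⟨η, hη, hgη⟩ := Metric.uniformContinuous_iff.1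
    (CompactSpace.uniformContinuous_of_continuous hg) (ε / 2) (half_pos hε)
  obtain ⟨N, hN⟩ := Metric.tendsto_atTop.1 hδ0 (min η (ε / 2)) (lt_min hη (half_pos hε))
  refine ⟨N, fun k hk => ?_⟩
  have hk' := hN k hk
  rw [Real.dist_0_eq_abs, abs_of_nonneg (hδ k), lt_min_iff] at hk'
  rw [Real.dist_0_eq_abs, abs_of_nonneg dist_nonneg]
  refine lt_of_le_of_lt (dist_pathTriple_net_le hg (B k) (hδ k) (hB k) hk'.2.le fun x y hxy => ?_)
    (half_lt_self hε)
  exact (hgη (hxy.trans_lt hk'.1)).le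

theorem exists_seq_finset_net (F : Type u) [MetricSpace F] [CompactSpace F] [Nonempty F] :
    ∃ B : ℕ → Finset F, (∀ k, Nonempty (B k)) ∧
      ∀ k x, ∃ b ∈ B k, dist x b ≤ (1 / 2 : ℝ) ^ k := by
  choose B hB using fun k : ℕ => exists_finset_net (F := F) (δ := (1 / 2 : ℝ) ^ k) (by positivity)
  exact ⟨B, fun k => (hB k).1, fun k => (hB k).2⟩

/-- The path is almost surely the limit of its restrictions to finer and finer nets, each a
continuous function of finitely many coordinates. No separability of `ℍ_pr` is needed. -/
theorem aemeasurable_pathTriple {Ω : Type v} [MeasurableSpace Ω] {P : Measure Ω} {G : F → Ω → ℝ}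
    (hm : ∀ x, AEMeasurable (G x) P) (hc : ∀ᵐ ω ∂P, Continuous fun x => G x ω) :
    AEMeasurable (fun ω => pathTriple F fun x => G x ω) P := by
  obtain ⟨B, hne, hB⟩ := exists_seq_finset_net F
  refine aemeasurable_of_tendsto_metrizable_ae atTop
    (f := fun k ω => pathTriple (B k) fun b => G b ω) (fun k => ?_) ?_
  · exact (continuous_pathTriple_of_finite (B k)).measurable.comp_aemeasurable
      (aemeasurable_pi_lambda _ fun b => hm b)
  · filter_upwards [hc] with ω hω
    exact tendsto_pathTriple_net hω (fun k => by positivity)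
      (tendsto_pow_atTop_nhds_zero_of_lt_one (by norm_num) (by norm_num)) hB

end PathTriple

/-! ### Convergence in distribution by approximation -/

theorem abs_integral_sub_integral_le {Ω : Type*} [MeasurableSpace Ω] {P : Measure Ω}
    [IsProbabilityMeasure P] {U V : Ω → ℝ} (hU : Integrable U P) (hV : Integrable V P) {a C : ℝ}
    (ha : 0 ≤ a) (hC : ∀ ω, |U ω - V ω| ≤ C) :
    |∫ ω, U ω ∂P - ∫ ω, V ω ∂P| ≤ a + C * P.real {ω | a < |U ω - V ω|} := by
  rw [← integral_sub hU hV]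
  have hT : NullMeasurableSet {ω | a < |U ω - V ω|} P :=
    nullMeasurableSet_lt aemeasurable_const (hU.sub hV).1.aemeasurable.abs
  have hind : Integrable ({ω | a < |U ω - V ω|}.indicator fun _ => C) P :=
    (integrable_const C).integrableOn.integrable_indicator₀ hT
  calc |∫ ω, U ω - V ω ∂P| ≤ ∫ ω, |U ω - V ω| ∂P := abs_integral_le_integral_abs
    _ ≤ ∫ ω, a + {ω | a < |U ω - V ω|}.indicator (fun _ => C) ω ∂P := by
        refine integral_mono (hU.sub hV).abs ((integrable_const a).add hind) fun ω => ?_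
        by_cases h : a < |U ω - V ω|
        · simpa [Set.indicator, h] using (hC ω).trans (le_add_of_nonneg_left ha)
        · simpa [Set.indicator, h] using not_lt.1 h
    _ = a + C * P.real {ω | a < |U ω - V ω|} := by
        rw [integral_add (integrable_const a) hind, integral_indicator₀ hT]
        simp [mul_comm]

theorem integrable_comp_of_dist_le {E Ω : Type*} [MeasurableSpace E] [MeasurableSpace Ω]
    {P : Measure Ω} [IsProbabilityMeasure P] {f : E → ℝ} (hf : Measurable f) {C : ℝ}
    (hC : ∀ x y, dist (f x) (f y) ≤ C) {U : Ω → E} (hU : AEMeasurable U P) :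
    Integrable (fun ω => f (U ω)) P := by
  obtain ⟨ω₀⟩ := nonempty_of_isProbabilityMeasure P
  refine Integrable.of_bound (hf.comp_aemeasurable hU).aestronglyMeasurable
    (‖f (U ω₀)‖ + C) (ae_of_all _ fun ω => ?_)
  have h1 := hC (U ω) (U ω₀)
  have h2 := norm_le_norm_add_norm_sub' (f (U ω)) (f (U ω₀))
  rw [dist_eq_norm] at h1
  linarith

/-- An `ε/3`-type argument with bounded Lipschitz test functions: `X n` is compared with `Y k n` off
a small event, `Y k n` with `Z k` by convergence in law, and `Z k` with `X₀` by dominated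
convergence. -/
theorem tendstoInDistribution_of_approx {E : Type*} [PseudoMetricSpace E] [MeasurableSpace E]
    [BorelSpace E] {Ω : ℕ → Type v} [∀ n, MeasurableSpace (Ω n)] {P : ∀ n, Measure (Ω n)}
    [∀ n, IsProbabilityMeasure (P n)] {Ω₀ : Type w} [MeasurableSpace Ω₀] {P₀ : Measure Ω₀}
    [IsProbabilityMeasure P₀] {X : ∀ n, Ω n → E} {X₀ : Ω₀ → E} {Y : ℕ → ∀ n, Ω n → E}
    {Z : ℕ → Ω₀ → E} (hX : ∀ n, AEMeasurable (X n) (P n)) (hX₀ : AEMeasurable X₀ P₀)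
    (hY : ∀ k, TendstoInDistribution (Y k) atTop (Z k) P P₀)
    (hZ : ∀ᵐ ω ∂P₀, Tendsto (fun k => Z k ω) atTop (𝓝 (X₀ ω)))
    (hYX : ∀ ε > 0, ∀ᶠ k in atTop, ∀ᶠ n in atTop,
      (P n).real {ω | ε < dist (Y k n ω) (X n ω)} ≤ ε) :
    TendstoInDistribution X atTop X₀ P P₀ := by
  refine ⟨hX, hX₀, tendsto_iff_forall_lipschitz_integral_tendsto.2 ?_⟩
  rintro f ⟨C, hC⟩ ⟨L, hL⟩
  have hfm : Measurable f := hL.continuous.measurable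
  have hC0 : 0 ≤ C := by
    obtain ⟨ω⟩ := nonempty_of_isProbabilityMeasure P₀
    exact dist_nonneg.trans (hC (X₀ ω) (X₀ ω))
  have hmap : ∀ n, ∫ x, f x ∂((P n).map (X n)) = ∫ ω, f (X n ω) ∂P n := fun n =>
    integral_map (hX n) hfm.aestronglyMeasurable
  have hmap₀ : ∫ x, f x ∂(P₀.map X₀) = ∫ ω, f (X₀ ω) ∂P₀ :=
    integral_map hX₀ hfm.aestronglyMeasurable
  simp only [ProbabilityMeasure.coe_mk, hmap, hmap₀]
  have hYf : ∀ k, Tendsto (fun n => ∫ ω, f (Y k n ω) ∂P n) atTop (𝓝 (∫ ω, f (Z k ω) ∂P₀)) := by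
    intro k
    have := tendsto_iff_forall_lipschitz_integral_tendsto.1 (hY k).tendsto f ⟨C, hC⟩ ⟨L, hL⟩
    simp only [ProbabilityMeasure.coe_mk] at this
    rw [integral_map (hY k).aemeasurable_limit hfm.aestronglyMeasurable] at this
    refine this.congr fun n => ?_
    exact integral_map ((hY k).forall_aemeasurable n) hfm.aestronglyMeasurable
  have hZf : Tendsto (fun k => ∫ ω, f (Z k ω) ∂P₀) atTop (𝓝 (∫ ω, f (X₀ ω) ∂P₀)) := by
    refine tendsto_integral_of_dominated_convergence (fun ω => ‖f (X₀ ω)‖ + C)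
      (fun k => (integrable_comp_of_dist_le hfm hC (hY k).aemeasurable_limit).1)
      ((integrable_comp_of_dist_le hfm hC hX₀).norm.add (integrable_const C)) (fun k => ae_of_all _ fun ω => ?_) ?_
    · have h1 := hC (Z k ω) (X₀ ω)
      have h2 := norm_le_norm_add_norm_sub' (f (Z k ω)) (f (X₀ ω))
      rw [dist_eq_norm] at h1
      linarith
    · filter_upwards [hZ] with ω hω
      exact (hL.continuous.tendsto _).comp hω
  refine Metric.tendsto_nhds.2 fun ε hε => ?_
  -- The error between `Y k n` and `X n` is at most `L * η` off the bad event and `C` on it, hence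
  -- at most `(L + C) * η`. The extra `1` keeps the denominator positive.
  set η : ℝ := ε / (4 * (L + C + 1)) with hη
  have hpos : (0 : ℝ) < L + C + 1 := by positivity
  have hη0 : 0 < η := by positivity
  have hηε : (L + C) * η ≤ ε / 4 := by
    have : (L + C + 1) * η = ε / 4 := by rw [hη]; field_simp
    nlinarith
  obtain ⟨k, hk1, hk2⟩ := ((hYX η hη0).and
    (Metric.tendsto_nhds.1 hZf (ε / 4) (by positivity))).exists
  filter_upwards [hk1, Metric.tendsto_nhds.1 (hYf k) (ε / 4) (by positivity)] with n hn1 hn2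
  have h3 : |∫ ω, f (Y k n ω) ∂P n - ∫ ω, f (X n ω) ∂P n| ≤ ε / 4 := by
    refine (abs_integral_sub_integral_le (integrable_comp_of_dist_le hfm hC ((hY k).forall_aemeasurable n))
      (integrable_comp_of_dist_le hfm hC (hX n)) (a := L * η) (by positivity) fun ω => hC _ _).trans ?_
    have : (P n).real {ω | L * η < |f (Y k n ω) - f (X n ω)|} ≤ η := by
      refine (measureReal_mono fun ω hω => ?_).trans hn1
      by_contra hcon
      exact absurd (lt_of_lt_of_le hω ((hL.dist_le_mul _ _).trans
        (mul_le_mul_of_nonneg_left (not_lt.1 hcon) L.2))) (lt_irrefl _)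
    nlinarith
  rw [Real.dist_eq] at hk2 hn2 ⊢
  have a1 := abs_lt.1 hk2
  have a2 := abs_lt.1 hn2
  have a3 := abs_le.1 h3
  exact abs_lt.2 ⟨by linarith, by linarith⟩

/-! ### Convergence of Gaussian vectors -/

theorem _root_.ProbabilityTheory.IsGaussianProcess.hasGaussianLaw_pi {ι Ω : Type*} [Fintype ι]
    [MeasurableSpace Ω] {P : Measure Ω} {X : ι → Ω → ℝ} (hX : IsGaussianProcess X P) :
    HasGaussianLaw (fun ω i => X i ω) P :=
  (hX.hasGaussianLaw Finset.univ).map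
    (ContinuousLinearMap.pi fun i : ι =>
      ContinuousLinearMap.proj (R := ℝ) (φ := fun _ : (Finset.univ : Finset ι) => ℝ)
        ⟨i, Finset.mem_univ i⟩)

theorem charFun_map_toLp {ι Ω : Type*} [Fintype ι] [MeasurableSpace Ω] {P : Measure Ω}
    [IsProbabilityMeasure P] {X : ι → Ω → ℝ} (hX : IsGaussianProcess X P)
    (hc : ∀ i, ∫ ω, X i ω ∂P = 0) (t : EuclideanSpace ℝ ι) :
    charFun (P.map fun ω => WithLp.toLp 2 fun i => X i ω) t =
      Complex.exp ((-(∑ i, ∑ j, t i * t j * cov[X i, X j; P]) / 2 : ℝ) : ℂ) := by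
  have hL : ∀ i, MemLp (X i) 2 P := fun i => (hX.hasGaussianLaw_eval i).memLp_two
  have hinner : ∀ ω, inner ℝ t (WithLp.toLp 2 fun i => X i ω) = ∑ i, t i * X i ω := fun ω => by
    simp [PiLp.inner_apply, mul_comm]
  rw [(hX.hasGaussianLaw_pi.toLp_pi 2).charFun_map_eq t]
  simp_rw [hinner]
  rw [variance_fun_sum (fun i => (hL i).const_mul (t i)),
    integral_finsetSum _ fun i _ => ((hL i).integrable one_le_two).const_mul (t i)]
  simp_rw [integral_const_mul, hc, covariance_const_mul_left, covariance_const_mul_right]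
  congr 1
  push_cast
  simp [neg_div, mul_assoc]

/-- The characteristic function of a centred Gaussian vector is a continuous function of its
covariances, so Lévy's continuity theorem applies. Characteristic functions need an inner product,
hence the detour through `EuclideanSpace`. -/
theorem tendstoInDistribution_gaussian {ι : Type*} [Fintype ι] {Ω : ℕ → Type v}
    [∀ n, MeasurableSpace (Ω n)] {P : ∀ n, Measure (Ω n)} [∀ n, IsProbabilityMeasure (P n)]
    {Ω₀ : Type w} [MeasurableSpace Ω₀] {P₀ : Measure Ω₀} [IsProbabilityMeasure P₀]
    {X : ∀ n, ι → Ω n → ℝ} {X₀ : ι → Ω₀ → ℝ} (hX : ∀ n, IsGaussianProcess (X n) (P n))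
    (hX₀ : IsGaussianProcess X₀ P₀) (hc : ∀ n i, ∫ ω, X n i ω ∂P n = 0)
    (hc₀ : ∀ i, ∫ ω, X₀ i ω ∂P₀ = 0)
    (hcov : ∀ i j, Tendsto (fun n => cov[X n i, X n j; P n]) atTop (𝓝 cov[X₀ i, X₀ j; P₀])) :
    TendstoInDistribution (fun n ω i => X n i ω) atTop (fun ω i => X₀ i ω) P P₀ := by
  have hG : ∀ n, HasGaussianLaw (fun ω i => X n i ω) (P n) := fun n => (hX n).hasGaussianLaw_pi
  have hG₀ : HasGaussianLaw (fun ω i => X₀ i ω) P₀ := hX₀.hasGaussianLaw_pi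
  have key : TendstoInDistribution (fun n ω => WithLp.toLp 2 fun i => X n i ω) atTop
      (fun ω => WithLp.toLp 2 fun i => X₀ i ω) P P₀ := by
    refine ⟨fun n => ((hG n).toLp_pi 2).aemeasurable, (hG₀.toLp_pi 2).aemeasurable,
      ProbabilityMeasure.tendsto_of_tendsto_charFun fun t => ?_⟩
    simp only [ProbabilityMeasure.coe_mk]
    simp_rw [charFun_map_toLp (hX _) (hc _), charFun_map_toLp hX₀ hc₀]
    refine (Complex.continuous_exp.tendsto _).comp ((Complex.continuous_ofReal.tendsto _).comp ?_)
    refine (Tendsto.neg ?_).div_const 2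
    exact tendsto_finsetSum _ fun i _ => tendsto_finsetSum _ fun j _ => (hcov i j).const_mul _
  exact key.continuous_comp (g := fun x : EuclideanSpace ℝ ι => WithLp.ofLp x)
    (PiLp.continuous_ofLp 2 _)

/-! ### Metric entropy -/

section Entropy

variable (F : Type u) [MetricSpace F]

/-- The general term of the entropy sum. -/
noncomputable def entropyTerm (α : ℝ) (l : ℕ) : ℝ≥0∞ :=
  ((Metric.coveringNumber ((2 : NNReal)⁻¹ ^ l) (Set.univ : Set F) : ℕ∞) : ℝ≥0∞) ^ 2 *
    ENNReal.ofReal (Real.exp (-(2 : ℝ) ^ (2 * α * (l : ℝ))))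

theorem entropyTail_eq_tsum (α : ℝ) (k : ℕ) :
    entropyTail F α k = ∑' j, entropyTerm F α (j + k) := by
  let e : ℕ ≃ Set.Ici k :=
    { toFun := fun j => ⟨j + k, Nat.le_add_left k j⟩
      invFun := fun l => l - k
      left_inv := fun j => Nat.add_sub_cancel j k
      right_inv := fun l => Subtype.ext (Nat.sub_add_cancel l.2) }
  exact (e.tsum_eq fun l : Set.Ici k => entropyTerm F α l).symm

theorem entropyTail_antitone (α : ℝ) : Antitone (entropyTail F α) := by
  refine antitone_nat_of_succ_le fun k => ?_
  rw [entropyTail_eq_tsum, entropyTail_eq_tsum]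
  have h : ∀ j, entropyTerm F α (j + (k + 1)) = entropyTerm F α (j + 1 + k) := fun j => by
    congr 1; ring
  simp_rw [h]
  exact ENNReal.tsum_comp_le_tsum_of_injective (Nat.succ_injective)
    fun j => entropyTerm F α (j + k)

variable [CompactSpace F]

theorem coveringNumber_univ_ne_top (l : ℕ) :
    Metric.coveringNumber ((2 : NNReal)⁻¹ ^ l) (Set.univ : Set F) ≠ ⊤ := by
  obtain ⟨N, hN, hfin, hcov⟩ := Metric.exists_finite_isCover_of_isCompact
    (ε := (2 : NNReal)⁻¹ ^ l) (by positivity) (isCompact_univ (X := F))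
  exact ne_top_of_le_ne_top (Set.encard_ne_top_iff.2 hfin) (hcov.coveringNumber_le_encard hN)

theorem entropyTerm_lt_top (α : ℝ) (l : ℕ) : entropyTerm F α l < ∞ := by
  refine ENNReal.mul_lt_top (ENNReal.pow_lt_top ?_) ENNReal.ofReal_lt_top
  exact (ENat.toENNReal_lt_top).2 (coveringNumber_univ_ne_top F l).lt_top

/-- By compactness every single term is finite, so finitely many initial terms do not matter. -/
theorem entropyTail_zero_lt_top {α : ℝ} {k : ℕ} (h : entropyTail F α k < ∞) :
    entropyTail F α 0 < ∞ := by
  rw [entropyTail_eq_tsum] at h ⊢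
  simp only [add_zero]
  rw [← Summable.sum_add_tsum_nat_add' (f := entropyTerm F α) (k := k) ENNReal.summable]
  exact ENNReal.add_lt_top.2 ⟨ENNReal.sum_lt_top.2 fun l _ => entropyTerm_lt_top F α l, h⟩

/-- A minimal `2⁻ˡ`-net. -/
noncomputable def levelNet (l : ℕ) : Finset F :=
  (Metric.finite_minimalCover (ε := (2 : NNReal)⁻¹ ^ l) (A := (Set.univ : Set F))).toFinset

variable {F} in
theorem exists_mem_levelNet (l : ℕ) (x : F) : ∃ a ∈ levelNet F l, dist x a ≤ (1 / 2 : ℝ) ^ l := by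
  obtain ⟨a, ha, hxa⟩ := Metric.isCover_minimalCover (coveringNumber_univ_ne_top F l)
    (Set.mem_univ x)
  refine ⟨a, by simpa [levelNet] using ha, ?_⟩
  have h : edist x a ≤ (((2 : NNReal)⁻¹ ^ l : NNReal) : ℝ≥0∞) := hxa
  rw [edist_nndist, ENNReal.coe_le_coe] at h
  simpa using (NNReal.coe_le_coe.2 h)

theorem card_levelNet (l : ℕ) : ((levelNet F l).card : ℝ≥0∞) =
    ((Metric.coveringNumber ((2 : NNReal)⁻¹ ^ l) (Set.univ : Set F) : ℕ∞) : ℝ≥0∞) := by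
  rw [← Metric.encard_minimalCover (coveringNumber_univ_ne_top F l),
    (Metric.finite_minimalCover).encard_eq_coe_toFinset_card]
  simp [levelNet]

open Classical in
/-- The points of two consecutive nets. -/
noncomputable def doubleNet (l : ℕ) : Finset F := levelNet F l ∪ levelNet F (l + 1)

theorem card_doubleNet_le (l : ℕ) : ((doubleNet F l).card : ℝ≥0∞) ≤
    2 * ((Metric.coveringNumber ((2 : NNReal)⁻¹ ^ (l + 1)) (Set.univ : Set F) : ℕ∞) : ℝ≥0∞) := by
  classical
  have h1 : ((doubleNet F l).card : ℝ≥0∞) ≤ (levelNet F l).card + (levelNet F (l + 1)).card := by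
    exact_mod_cast Finset.card_union_le _ _
  refine h1.trans ?_
  rw [card_levelNet, card_levelNet, two_mul]
  gcongr
  refine Metric.coveringNumber_anti ?_
  exact pow_le_pow_of_le_one (by positivity) (by norm_num) (Nat.le_succ l)

end Entropy

/-! ### Chaining along nets -/

/-- The threshold for the increments at level `l`. -/
noncomputable def levelBound (α : ℝ) (l : ℕ) : ℝ :=
  8 * (1 / 2 : ℝ) ^ l * (Real.sqrt 2 * (2 : ℝ) ^ (α * ((l : ℝ) + 1)))

theorem levelBound_nonneg (α : ℝ) (l : ℕ) : 0 ≤ levelBound α l := by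
  unfold levelBound; positivity

theorem summable_levelBound {α : ℝ} (hα : α < 1) : Summable (levelBound α) := by
  have h : ∀ l, levelBound α l =
      8 * Real.sqrt 2 * (2 : ℝ) ^ α * ((1 / 2 : ℝ) * (2 : ℝ) ^ α) ^ l := fun l => by
    rw [levelBound, mul_add, Real.rpow_add two_pos, Real.rpow_mul two_pos.le, Real.rpow_natCast,
      mul_pow, mul_one]
    ring
  simp_rw [funext h]
  refine (summable_geometric_of_lt_one (by positivity) ?_).mul_left _
  have : (2 : ℝ) ^ α < 2 ^ (1 : ℝ) := Real.rpow_lt_rpow_of_exponent_lt one_lt_two hα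
  rw [Real.rpow_one] at this
  linarith

/-- The total oscillation allowed from level `k` on. -/
noncomputable def tailBound (α : ℝ) (k : ℕ) : ℝ := ∑' j, levelBound α (j + k)

theorem tendsto_tailBound (α : ℝ) : Tendsto (tailBound α) atTop (𝓝 0) :=
  tendsto_sum_nat_add _

theorem sum_levelBound_le_tailBound {α : ℝ} (hα : α < 1) (k m : ℕ) :
    ∑ j ∈ Finset.range m, levelBound α (j + k) ≤ tailBound α k :=
  ((summable_nat_add_iff k).2 (summable_levelBound hα)).sum_le_tsum _
    fun _ _ => levelBound_nonneg _ _

theorem levelBound_le_tailBound {α : ℝ} (hα : α < 1) (k : ℕ) : levelBound α k ≤ tailBound α k := by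
  simpa using sum_levelBound_le_tailBound hα k 1

section Chaining

variable {F : Type u} [MetricSpace F] [CompactSpace F]

/-- The increments of `g` along close points of the nets of levels `l` and `l + 1` are small. -/
def SmallIncrements (α : ℝ) (g : F → ℝ) (l : ℕ) : Prop :=
  ∀ a ∈ doubleNet F l, ∀ b ∈ doubleNet F l, dist a b ≤ 8 * (1 / 2 : ℝ) ^ l →
    |g a - g b| ≤ levelBound α l

/-- Repeatedly moving to a nearest point of the next coarser net costs `2⁻ˡ` in distance and
`levelBound α l` in value per step. The subtracted term in the distance bound is the exact geometric
remainder, which makes the induction close. -/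
theorem SmallIncrements.exists_ancestor {α : ℝ} {g : F → ℝ} {k : ℕ}
    (h : ∀ l ≥ k, SmallIncrements α g l) (m : ℕ) : ∀ a ∈ levelNet F (m + k), ∃ c ∈ levelNet F k,
      dist a c ≤ 2 * (1 / 2 : ℝ) ^ k - 2 * (1 / 2 : ℝ) ^ (m + k) ∧
      |g a - g c| ≤ ∑ j ∈ Finset.range m, levelBound α (j + k) := by
  classical
  induction m with
  | zero =>
    intro a ha
    rw [zero_add] at ha
    exact ⟨a, ha, by simp, by simp⟩
  | succ m ih =>
    intro a ha
    obtain ⟨b, hb, hab⟩ := exists_mem_levelNet (m + k) a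
    obtain ⟨c, hc, hbc, hgbc⟩ := ih b hb
    have e : m + 1 + k = m + k + 1 := by ring
    have hpos : (0 : ℝ) < (1 / 2 : ℝ) ^ (m + k) := by positivity
    refine ⟨c, hc, ?_, ?_⟩
    · rw [e, pow_succ]
      have := dist_triangle a b c
      linarith
    · rw [Finset.sum_range_succ]
      have h1 := h (m + k) (Nat.le_add_left k m) a
        (Finset.mem_union_right _ (by rwa [e] at ha)) b (Finset.mem_union_left _ hb)
        (by linarith)
      have := abs_sub_le (g a) (g b) (g c)
      linarith

/-- Both points descend to ancestors in the net of level `k`. The ancestors are within `2 + 4 + 2 =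
8` times `2⁻ᵏ` of each other, which is why `SmallIncrements` allows the factor `8`. The two descents
and the one step between ancestors each cost at most `tailBound α k`. -/
theorem SmallIncrements.abs_sub_le {α : ℝ} (hα : α < 1) {g : F → ℝ} {k : ℕ}
    (h : ∀ l ≥ k, SmallIncrements α g l) {m n : ℕ} (hm : k ≤ m) (hn : k ≤ n) {a b : F}
    (ha : a ∈ levelNet F m) (hb : b ∈ levelNet F n) (hab : dist a b ≤ 4 * (1 / 2 : ℝ) ^ k) :
    |g a - g b| ≤ 3 * tailBound α k := by
  classical
  obtain ⟨m, rfl⟩ := Nat.exists_eq_add_of_le' hm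
  obtain ⟨n, rfl⟩ := Nat.exists_eq_add_of_le' hn
  obtain ⟨c, hc, hac, hgc⟩ := SmallIncrements.exists_ancestor h m a ha
  obtain ⟨d, hd, hbd, hgd⟩ := SmallIncrements.exists_ancestor h n b hb
  have hp1 : (0 : ℝ) < (1 / 2 : ℝ) ^ (m + k) := by positivity
  have hp2 : (0 : ℝ) < (1 / 2 : ℝ) ^ (n + k) := by positivity
  have hcd : dist c d ≤ 8 * (1 / 2 : ℝ) ^ k := by
    have := dist_triangle4 c a b d
    rw [dist_comm c a] at this
    linarith
  have h1 := h k le_rfl c (Finset.mem_union_left _ hc) d (Finset.mem_union_left _ hd) hcd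
  have h2 := sum_levelBound_le_tailBound hα k m
  have h3 := sum_levelBound_le_tailBound hα k n
  have h4 := levelBound_le_tailBound hα k
  rw [abs_le] at *
  constructor <;> linarith

/-- A point of the `2⁻ˡ`-net next to `x`. -/
noncomputable def netProj (l : ℕ) (x : F) : F := (exists_mem_levelNet l x).choose

theorem netProj_mem (l : ℕ) (x : F) : netProj l x ∈ levelNet F l :=
  (exists_mem_levelNet l x).choose_spec.1

theorem dist_netProj_le (l : ℕ) (x : F) : dist x (netProj l x) ≤ (1 / 2 : ℝ) ^ l :=
  (exists_mem_levelNet l x).choose_spec.2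

theorem tendsto_netProj (x : F) : Tendsto (fun l => netProj l x) atTop (𝓝 x) := by
  rw [tendsto_iff_dist_tendsto_zero]
  exact squeeze_zero (fun _ => dist_nonneg) (fun l => by rw [dist_comm]; exact dist_netProj_le l x)
    (tendsto_pow_atTop_nhds_zero_of_lt_one (by norm_num) (by norm_num))

theorem dist_netProj_netProj_le {x y : F} {k m n : ℕ} (hm : k ≤ m) (hn : k ≤ n)
    (hxy : dist x y ≤ 2 * (1 / 2 : ℝ) ^ k) :
    dist (netProj m x) (netProj n y) ≤ 4 * (1 / 2 : ℝ) ^ k := by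
  have h1 := dist_triangle4 (netProj m x) x y (netProj n y)
  have h2 := dist_netProj_le m x
  have h3 := dist_netProj_le n y
  have h4 : (1 / 2 : ℝ) ^ m ≤ (1 / 2 : ℝ) ^ k :=
    pow_le_pow_of_le_one (by norm_num) (by norm_num) hm
  have h5 : (1 / 2 : ℝ) ^ n ≤ (1 / 2 : ℝ) ^ k :=
    pow_le_pow_of_le_one (by norm_num) (by norm_num) hn
  rw [dist_comm (netProj m x) x] at h1
  linarith

/-- Here `g` matters only on the nets and `g'` is its limit along them. This serves both to
construct a continuous version and to bound the modulus of a given one. -/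
theorem SmallIncrements.abs_sub_le_of_tendsto {α : ℝ} (hα : α < 1) {g g' : F → ℝ} {k : ℕ}
    (h : ∀ l ≥ k, SmallIncrements α g l)
    (hg : ∀ x, Tendsto (fun m => g (netProj m x)) atTop (𝓝 (g' x))) {x y : F}
    (hxy : dist x y ≤ 2 * (1 / 2 : ℝ) ^ k) : |g' x - g' y| ≤ 3 * tailBound α k := by
  refine le_of_tendsto ((hg x).sub (hg y)).abs (eventually_atTop.2 ⟨k, fun m hm => ?_⟩)
  exact SmallIncrements.abs_sub_le hα h hm hm (netProj_mem _ _) (netProj_mem _ _)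
    (dist_netProj_netProj_le hm hm hxy)

theorem SmallIncrements.exists_tendsto {α : ℝ} (hα : α < 1) {g : F → ℝ} {k : ℕ}
    (h : ∀ l ≥ k, SmallIncrements α g l) (x : F) :
    ∃ c, Tendsto (fun m => g (netProj m x)) atTop (𝓝 c) := by
  have hc : CauchySeq fun m => g (netProj (m + k) x) := by
    refine cauchySeq_of_le_tendsto_0 (fun N => 3 * tailBound α (N + k)) (fun m n N hm hn => ?_) ?_
    -- The bound is applied at the base level `N + k`, with both points projections of the same `x`.
    · exact SmallIncrements.abs_sub_le hα (fun l hl => h l (by omega)) (by omega) (by omega)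
        (netProj_mem _ _) (netProj_mem _ _)
        (dist_netProj_netProj_le (by omega) (by omega) (by rw [dist_self]; positivity))
    · simpa using ((tendsto_add_atTop_iff_nat k).2 (tendsto_tailBound α)).const_mul 3
  obtain ⟨c, hc⟩ := cauchySeq_tendsto_of_complete hc
  exact ⟨c, (tendsto_add_atTop_iff_nat k).1 hc⟩

theorem SmallIncrements.continuous_of_tendsto {α : ℝ} (hα : α < 1) {g g' : F → ℝ} {k : ℕ}
    (h : ∀ l ≥ k, SmallIncrements α g l)
    (hg : ∀ x, Tendsto (fun m => g (netProj m x)) atTop (𝓝 (g' x))) : Continuous g' := by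
  refine Metric.continuous_iff.2 fun y ε hε => ?_
  have h0 : Tendsto (fun K => 3 * tailBound α K) atTop (𝓝 0) := by
    simpa using (tendsto_tailBound α).const_mul 3
  obtain ⟨K, hK, hkK⟩ := ((h0.eventually_lt_const hε).and (eventually_ge_atTop k)).exists
  refine ⟨2 * (1 / 2 : ℝ) ^ K, by positivity, fun x hx => ?_⟩
  exact (SmallIncrements.abs_sub_le_of_tendsto hα (fun l hl => h l (hkK.trans hl)) hg
    hx.le).trans_lt hK

end Chaining

/-! ### Gaussian processes -/

namespace IsCentredGaussian

variable {F : Type u} [MetricSpace F] {Ω : Type v} [MeasurableSpace Ω] {P : Measure Ω}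
  [IsProbabilityMeasure P] {G : F → Ω → ℝ}

omit [IsProbabilityMeasure P] in
theorem memLp (hG : IsCentredGaussian G P) (x : F) : MemLp (G x) 2 P :=
  (hG.gaussian.hasGaussianLaw_eval x).memLp_two

theorem variance_sub (hG : IsCentredGaussian G P) (x y : F) :
    Var[fun ω => G x ω - G y ω; P] = dist x y ^ 2 := by
  have h0 : ∫ ω, G x ω - G y ω ∂P = 0 := by
    rw [integral_sub ((hG.memLp x).integrable one_le_two) ((hG.memLp y).integrable one_le_two),
      hG.centred, hG.centred, sub_zero]
  have hm : AEMeasurable (fun ω => G x ω - G y ω) P :=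
    ((hG.memLp x).sub (hG.memLp y)).aestronglyMeasurable.aemeasurable
  rw [variance_of_integral_eq_zero hm h0, hG.dist_eq,
    Real.sq_sqrt (integral_nonneg fun ω => sq_nonneg _)]

/-- The increment is centred Gaussian with variance `dist x y ^ 2`. Allowing any `s` above the
distance gives one tail bound for all close pairs. -/
theorem hasSubgaussianMGF_sub (hG : IsCentredGaussian G P) (x y : F) {s : NNReal}
    (hs : dist x y ≤ s) : HasSubgaussianMGF (fun ω => G x ω - G y ω) (s ^ 2) P := by
  have hlaw := (hG.gaussian.hasGaussianLaw_fun_sub (s := x) (t := y)).map_eq_gaussianReal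
  have h0 : ∫ ω, G x ω - G y ω ∂P = 0 := by
    rw [integral_sub ((hG.memLp x).integrable one_le_two) ((hG.memLp y).integrable one_le_two),
      hG.centred, hG.centred, sub_zero]
  rw [h0, hG.variance_sub] at hlaw
  constructor
  · intro t
    have h := integrable_exp_mul_gaussianReal (μ := 0) (v := (dist x y ^ 2).toNNReal) t
    rw [← hlaw] at h
    exact h.comp_aemeasurable ((hG.memLp x).sub (hG.memLp y)).aemeasurable
  · intro t
    rw [mgf_gaussianReal hlaw, Real.coe_toNNReal _ (sq_nonneg _), zero_mul, zero_add]
    push_cast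
    gcongr

theorem measure_le_abs_sub_le (hG : IsCentredGaussian G P) (x y : F) {s u : ℝ} (hs0 : 0 ≤ s)
    (hs : dist x y ≤ s) (hu : 0 ≤ u) :
    P {ω | u ≤ |G x ω - G y ω|} ≤ ENNReal.ofReal (2 * Real.exp (-u ^ 2 / (2 * s ^ 2))) := by
  lift s to NNReal using hs0
  have h1 := (hG.hasSubgaussianMGF_sub x y hs).measure_ge_le hu
  have h2 := (hG.hasSubgaussianMGF_sub y x (by rwa [dist_comm])).measure_ge_le hu
  have h3 : {ω | u ≤ |G x ω - G y ω|} ⊆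
      {ω | u ≤ G x ω - G y ω} ∪ {ω | u ≤ G y ω - G x ω} := fun ω hω => by
    rcases le_abs.1 (show u ≤ |G x ω - G y ω| from hω) with h | h
    · exact Or.inl h
    · exact Or.inr (by simpa using h)
  refine (measure_mono h3).trans ((measure_union_le _ _).trans ?_)
  rw [← ofReal_measureReal, ← ofReal_measureReal, ← ENNReal.ofReal_add measureReal_nonneg
    measureReal_nonneg]
  refine ENNReal.ofReal_le_ofReal ?_
  push_cast at h1 h2
  linarith

variable [CompactSpace F]

/-- `levelBound` is chosen so that, with scale `s = 8 * 2⁻ˡ`, the exponent `u² / (2s²)` equals `2 ^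
(2α(l+1))`, the one in `entropyTerm` at level `l + 1`. A union bound runs over at most `(2N)²`
pairs, each with a two-sided tail, whence `4 * 2 = 8`. -/
theorem measure_not_smallIncrements_le (hG : IsCentredGaussian G P) (α : ℝ) (l : ℕ) :
    P {ω | ¬ SmallIncrements α (fun x => G x ω) l} ≤ 8 * entropyTerm F α (l + 1) := by
  classical
  set q : ℝ≥0∞ := ENNReal.ofReal (Real.exp (-(2 : ℝ) ^ (2 * α * ((l + 1 : ℕ) : ℝ)))) with hq
  have hpair : ∀ a b : F, P {ω | dist a b ≤ 8 * (1 / 2 : ℝ) ^ l ∧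
      levelBound α l ≤ |G a ω - G b ω|} ≤ 2 * q := by
    intro a b
    by_cases hab : dist a b ≤ 8 * (1 / 2 : ℝ) ^ l
    · simp only [hab, true_and]
      refine (hG.measure_le_abs_sub_le a b (by positivity) hab (levelBound_nonneg α l)).trans_eq ?_
      rw [ENNReal.ofReal_mul zero_le_two, ENNReal.ofReal_ofNat]
      congr 4
      have h8 : (8 * (1 / 2 : ℝ) ^ l) ^ 2 ≠ 0 := by positivity
      have h2 : (2 : ℝ) ^ (2 * α * ((l + 1 : ℕ) : ℝ)) = ((2 : ℝ) ^ (α * ((l : ℝ) + 1))) ^ 2 := by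
        rw [← Real.rpow_natCast, ← Real.rpow_mul two_pos.le]
        congr 1
        push_cast
        ring
      rw [h2, levelBound, mul_pow, mul_pow (Real.sqrt 2), Real.sq_sqrt zero_le_two, neg_div]
      field_simp
    · simp only [hab, false_and, Set.ofPred_false, measure_empty, zero_le]
  have hsub : {ω | ¬ SmallIncrements α (fun x => G x ω) l} ⊆
      ⋃ p ∈ doubleNet F l ×ˢ doubleNet F l, {ω | dist p.1 p.2 ≤ 8 * (1 / 2 : ℝ) ^ l ∧
        levelBound α l ≤ |G p.1 ω - G p.2 ω|} := by
    intro ω hω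
    simp only [SmallIncrements, Set.mem_ofPred_eq, not_forall, not_le] at hω
    obtain ⟨a, ha, b, hb, hab, h⟩ := hω
    exact Set.mem_iUnion₂.2 ⟨(a, b), Finset.mem_product.2 ⟨ha, hb⟩, hab, h.le⟩
  calc P {ω | ¬ SmallIncrements α (fun x => G x ω) l}
      ≤ ∑ p ∈ doubleNet F l ×ˢ doubleNet F l, 2 * q :=
        (measure_mono hsub).trans ((measure_biUnion_finset_le _ _).trans
          (Finset.sum_le_sum fun p _ => hpair p.1 p.2))
    _ = (doubleNet F l).card ^ 2 * (2 * q) := by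
        rw [Finset.sum_const, Finset.card_product, nsmul_eq_mul, sq, Nat.cast_mul]
    _ ≤ (2 * ((Metric.coveringNumber ((2 : NNReal)⁻¹ ^ (l + 1)) (Set.univ : Set F) : ℕ∞) :
          ℝ≥0∞)) ^ 2 * (2 * q) := by
        gcongr
        exact card_doubleNet_le F l
    _ = 8 * entropyTerm F α (l + 1) := by
        rw [entropyTerm, ← hq]
        ring

theorem tsum_measure_not_smallIncrements_le (hG : IsCentredGaussian G P) (α : ℝ) (k : ℕ) :
    ∑' j, P {ω | ¬ SmallIncrements α (fun x => G x ω) (j + k)} ≤ 8 * entropyTail F α k := by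
  refine (ENNReal.tsum_le_tsum fun j => hG.measure_not_smallIncrements_le α (j + k)).trans ?_
  rw [ENNReal.tsum_mul_left]
  refine mul_le_mul_right ?_ _
  exact (entropyTail_eq_tsum F α (k + 1)).symm.trans_le (entropyTail_antitone F α (Nat.le_succ k))

theorem measure_not_modulus_le (hG : IsCentredGaussian G P) {α : ℝ} (hα : α < 1)
    {G' : F → Ω → ℝ} (hG' : IsContinuousVersion G G' P) (k : ℕ) :
    P {ω | ¬ ∀ x y, dist x y ≤ 2 * (1 / 2 : ℝ) ^ k → |G' x ω - G' y ω| ≤ 3 * tailBound α k} ≤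
      8 * entropyTail F α k := by
  -- A version agrees with `G` almost surely at each single point only. Simultaneous agreement holds
  -- on the countable union of the nets, and continuity does the rest.
  have hnet : ∀ᵐ ω ∂P, ∀ m, ∀ a ∈ levelNet F m, G' a ω = G a ω := by
    refine ae_all_iff.2 fun m => ?_
    exact (Finset.eventually_all _).2 fun a _ => hG'.version a
  refine le_trans (measure_mono_ae (t := ⋃ j, {ω | ¬ SmallIncrements α (fun x => G x ω) (j + k)})
    ?_) ((measure_iUnion_le _).trans (hG.tsum_measure_not_smallIncrements_le α k))
  filter_upwards [hnet, hG'.continuous] with ω h1 h2 hω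
  by_contra hcon
  refine hω fun x y hxy => SmallIncrements.abs_sub_le_of_tendsto hα (g := fun x => G x ω)
    (g' := fun x => G' x ω) (fun l hl => ?_) (fun x => ?_) hxy
  · by_contra hl'
    obtain ⟨j, rfl⟩ := Nat.exists_eq_add_of_le' hl
    exact hcon (Set.mem_iUnion.2 ⟨j, hl'⟩)
  · refine ((h2.tendsto x).comp (tendsto_netProj x)).congr fun m => ?_
    exact h1 m _ (netProj_mem m x)

/-- By Borel–Cantelli the increments are almost surely small from some level on, so the values along
the nets converge at all points at once, to a continuous limit. The limit is a version because the
Gaussian tail bound makes the same values converge to `G x` in probability. -/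
theorem exists_continuousVersion (hG : IsCentredGaussian G P) (hF : EntropySummable F) :
    ∃ G' : F → Ω → ℝ, IsContinuousVersion G G' P := by
  obtain ⟨α, ⟨-, hα⟩, htail⟩ := hF
  have hgood : ∀ᵐ ω ∂P, ∃ k, ∀ l ≥ k, SmallIncrements α (fun x => G x ω) l := by
    have h := hG.tsum_measure_not_smallIncrements_le α 0
    simp only [add_zero] at h
    filter_upwards [ae_eventually_notMem (ne_top_of_le_ne_top
      (ENNReal.mul_ne_top (by simp) htail.ne) h)] with ω hω
    simpa using eventually_atTop.1 hω
  have hlim : ∀ᵐ ω ∂P, ∀ x, Tendsto (fun m => G (netProj m x) ω) atTop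
      (𝓝 (limUnder atTop fun m => G (netProj m x) ω)) := by
    filter_upwards [hgood] with ω ⟨k, hk⟩ x
    exact tendsto_nhds_limUnder (SmallIncrements.exists_tendsto hα hk x)
  -- Where the limit does not exist, `limUnder` takes a junk value. This concerns a null set only.
  refine ⟨fun x ω => limUnder atTop fun m => G (netProj m x) ω, fun x => ?_, ?_⟩
  · refine tendstoInMeasure_ae_unique (f := fun m => G (netProj m x)) (u := atTop)
      (tendstoInMeasure_of_tendsto_ae (fun m => (hG.memLp _).1) (hlim.mono fun ω h => h x)) ?_
    refine tendstoInMeasure_iff_dist.2 fun ε hε => ?_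
    have hexp : Tendsto (fun m : ℕ => ENNReal.ofReal
        (2 * Real.exp (-ε ^ 2 / (2 * ((1 / 2 : ℝ) ^ m) ^ 2)))) atTop (𝓝 0) := by
      rw [← ENNReal.ofReal_zero]
      refine (ENNReal.continuous_ofReal.tendsto _).comp ?_
      rw [← mul_zero (2 : ℝ)]
      refine (Real.tendsto_exp_atBot.comp ?_).const_mul 2
      have h4 : ∀ m : ℕ, -ε ^ 2 / (2 * ((1 / 2 : ℝ) ^ m) ^ 2) = -(ε ^ 2 / 2 * 4 ^ m) := fun m => by
        rw [← pow_mul, mul_comm m 2, pow_mul, show ((1 / 2 : ℝ) ^ 2) = 4⁻¹ by norm_num, inv_pow]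
        field_simp
      simp_rw [h4]
      exact tendsto_neg_atTop_atBot.comp ((tendsto_pow_atTop_atTop_of_one_lt
        (by norm_num)).const_mul_atTop (by positivity))
    refine tendsto_of_tendsto_of_tendsto_of_le_of_le tendsto_const_nhds hexp
      (fun _ => zero_le) fun m => ?_
    exact hG.measure_le_abs_sub_le _ _ (by positivity)
      ((dist_comm _ _).trans_le (dist_netProj_le m x)) hε.le
  · filter_upwards [hgood, hlim] with ω ⟨k, hk⟩ h
    exact SmallIncrements.continuous_of_tendsto hα hk h

end IsCentredGaussian

/-! ### Couplings of nearby triples -/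

/-- What the smallness of `covEDist` provides: isometric embeddings into a common space, under which
each of the two spaces is within `ε` of the other, with nearby values on the diagonal. -/
structure CovCoupling {F₁ F₂ : Type u} [MetricSpace F₁] [MetricSpace F₂]
    (S₁ : F₁ → F₁ → ℝ) (S₂ : F₂ → F₂ → ℝ) (ε : ℝ) : Type (u + 1) where
  space : Type u
  [metric : MetricSpace space]
  [compact : CompactSpace space]
  inl : F₁ → space
  inr : F₂ → space
  isometry_inl : Isometry inl
  isometry_inr : Isometry inr
  toRight : F₁ → F₂
  toLeft : F₂ → F₁
  toLeft' : F₂ → F₁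
  dist_toRight_le : ∀ x, dist (inl x) (inr (toRight x)) ≤ ε
  dist_toLeft_le : ∀ y, dist (inl (toLeft y)) (inr y) ≤ ε
  dist_toLeft'_le : ∀ y, dist (inl (toLeft' y)) (inr y) ≤ ε
  abs_sub_le : ∀ y, |S₁ (toLeft y) (toLeft' y) - S₂ y y| ≤ ε

attribute [instance] CovCoupling.metric CovCoupling.compact

theorem nonempty_covCoupling {F₁ F₂ : Type u} [MetricSpace F₁] [MetricSpace F₂]
    {S₁ : F₁ → F₁ → ℝ} {S₂ : F₂ → F₂ → ℝ} {ε : ℝ} (hε : 0 ≤ ε)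
    (h : covEDist S₁ S₂ < ENNReal.ofReal ε) : Nonempty (CovCoupling S₁ S₂ ε) := by
  simp only [covEDist, iInf_lt_iff] at h
  obtain ⟨Z, _, _, f₁, f₂, h₁, h₂, C, hC, h⟩ := h
  have key : ∀ x x' y y', ((x, x'), (y, y')) ∈ C →
      dist (f₁ x) (f₂ y) ≤ ε ∧ dist (f₁ x') (f₂ y') ≤ ε ∧ |S₁ x x' - S₂ y y'| ≤ ε := by
    intro x x' y y' hp
    have := (le_iSup₂ (f := fun (p : (F₁ × F₁) × (F₂ × F₂)) (_ : p ∈ C) =>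
      max (max (edist (f₁ p.1.1) (f₂ p.2.1)) (edist (f₁ p.1.2) (f₂ p.2.2)))
      (edist (S₁ p.1.1 p.1.2) (S₂ p.2.1 p.2.2))) _ hp).trans h.le
    simp only [max_le_iff, edist_le_ofReal hε] at this
    exact ⟨this.1.1, this.1.2, this.2⟩
  choose p hp using fun x : F₁ => hC.1 (x, x)
  choose q hq using fun y : F₂ => hC.2 (y, y)
  exact ⟨{
    space := Z, inl := f₁, inr := f₂, isometry_inl := h₁, isometry_inr := h₂
    toRight := fun x => (p x).1
    toLeft := fun y => (q y).1
    toLeft' := fun y => (q y).2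
    dist_toRight_le := fun x => (key _ _ _ _ (hp x)).1
    dist_toLeft_le := fun y => (key _ _ _ _ (hq y)).1
    dist_toLeft'_le := fun y => (key _ _ _ _ (hq y)).2.1
    abs_sub_le := fun y => (key _ _ _ _ (hq y)).2.2 }⟩

namespace CovCoupling

variable {F₁ F₂ : Type u} [MetricSpace F₁] [MetricSpace F₂] {S₁ : F₁ → F₁ → ℝ}
  {S₂ : F₂ → F₂ → ℝ} {ε : ℝ}

theorem abs_dist_toLeft_sub_le (c : CovCoupling S₁ S₂ ε) (y y' : F₂) :
    |dist (c.toLeft y) (c.toLeft y') - dist y y'| ≤ 2 * ε := by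
  have h1 := c.dist_toLeft_le y
  have h2 := c.dist_toLeft_le y'
  rw [← c.isometry_inl.dist_eq, ← c.isometry_inr.dist_eq, abs_le]
  have h3 := dist_triangle4 (c.inl (c.toLeft y)) (c.inr y) (c.inr y') (c.inl (c.toLeft y'))
  have h4 := dist_triangle4 (c.inr y) (c.inl (c.toLeft y)) (c.inl (c.toLeft y')) (c.inr y')
  rw [dist_comm (c.inr y') _] at h3
  rw [dist_comm (c.inr y) (c.inl _)] at h4
  constructor <;> linarith

theorem dist_toLeft_toLeft'_le (c : CovCoupling S₁ S₂ ε) (y : F₂) :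
    dist (c.toLeft y) (c.toLeft' y) ≤ 2 * ε := by
  rw [← c.isometry_inl.dist_eq]
  have := dist_triangle_right (c.inl (c.toLeft y)) (c.inl (c.toLeft' y)) (c.inr y)
  linarith [c.dist_toLeft_le y, c.dist_toLeft'_le y]

variable [CompactSpace F₁]

/-- A `2⁻⁽ˡ⁺¹⁾`-net of `F₁`, moved to `F₂` by `toRight`, covers with radius `2⁻⁽ˡ⁺¹⁾ + 2ε ≤ 2⁻ˡ`. -/
theorem coveringNumber_le (c : CovCoupling S₁ S₂ ε) {l : ℕ} (hε : 2 * ε ≤ (1 / 2 : ℝ) ^ (l + 1)) :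
    ((Metric.coveringNumber ((2 : NNReal)⁻¹ ^ l) (Set.univ : Set F₂) : ℕ∞) : ℝ≥0∞) ≤
      ((Metric.coveringNumber ((2 : NNReal)⁻¹ ^ (l + 1)) (Set.univ : Set F₁) : ℕ∞) : ℝ≥0∞) := by
  classical
  have hcov : Metric.IsCover ((2 : NNReal)⁻¹ ^ l) (Set.univ : Set F₂)
      ((levelNet F₁ (l + 1)).image c.toRight : Finset F₂) := by
    intro y _
    obtain ⟨a, ha, hya⟩ := exists_mem_levelNet (l + 1) (c.toLeft y)
    refine ⟨c.toRight a, by simpa using ⟨a, ha, rfl⟩, ?_⟩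
    change edist y (c.toRight a) ≤ _
    rw [edist_nndist, ENNReal.coe_le_coe, ← NNReal.coe_le_coe, coe_nndist,
      ← c.isometry_inr.dist_eq]
    have h1 := dist_triangle4 (c.inr y) (c.inl (c.toLeft y)) (c.inl a) (c.inr (c.toRight a))
    rw [c.isometry_inl.dist_eq, dist_comm (c.inr y) (c.inl _)] at h1
    have h2 := c.dist_toLeft_le y
    have h3 := c.dist_toRight_le a
    have h4 : (1 / 2 : ℝ) ^ l = 2 * (1 / 2 : ℝ) ^ (l + 1) := by rw [pow_succ]; ring
    have h5 : (((2 : NNReal)⁻¹ ^ l : NNReal) : ℝ) = (1 / 2 : ℝ) ^ l := by simp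
    rw [h5, h4]
    linarith
  have h1 := hcov.coveringNumber_le_encard (Set.subset_univ _)
  rw [Set.encard_coe_eq_coe_finsetCard] at h1
  rw [← card_levelNet F₁]
  refine (ENat.toENNReal_le.2 h1).trans ?_
  rw [ENat.toENNReal_coe]
  exact_mod_cast Finset.card_image_le

theorem entropyTerm_le (c : CovCoupling S₁ S₂ ε) {l : ℕ} (hε : 2 * ε ≤ (1 / 2 : ℝ) ^ (l + 1))
    {α β : ℝ} (hαβ : α * ((l : ℝ) + 1) ≤ β * l) :
    entropyTerm F₂ β l ≤ entropyTerm F₁ α (l + 1) := by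
  unfold entropyTerm
  gcongr ?_ ^ 2 * ENNReal.ofReal (Real.exp (-?_))
  · exact c.coveringNumber_le hε
  · refine Real.rpow_le_rpow_of_exponent_le one_le_two ?_
    push_cast
    linarith

end CovCoupling

theorem entropySummable_of_covCoupling {F : ℕ → Type u} [∀ n, MetricSpace (F n)]
    [∀ n, CompactSpace (F n)] {F₀ : Type u} [MetricSpace F₀] [CompactSpace F₀]
    {S : ∀ n, F n → F n → ℝ} {S₀ : F₀ → F₀ → ℝ} {ε : ℕ → ℝ} (hε : Tendsto ε atTop (𝓝 0))
    (hc : ∀ᶠ n in atTop, Nonempty (CovCoupling (S n) S₀ (ε n))) {α : ℝ} (hα : α ∈ Set.Ioo 0 1)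
    (htail : Tendsto (fun k => limsup (fun n => entropyTail (F n) α k) atTop) atTop (𝓝 0)) :
    EntropySummable F₀ := by
  obtain ⟨hα0, hα1⟩ := hα
  -- The larger exponent `β = (1 + α) / 2` absorbs the loss of one level: `α(l + 1) ≤ βl` as soon as
  -- `l ≥ 2α / (1 - α)`.
  refine ⟨(1 + α) / 2, ⟨by linarith, by linarith⟩, ?_⟩
  obtain ⟨k₀, hk₀⟩ := (htail.eventually_lt_const zero_lt_one).exists
  have hev := eventually_lt_of_limsup_lt hk₀
  obtain ⟨k₁, hk₁⟩ := exists_nat_ge (2 * α / (1 - α))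
  refine entropyTail_zero_lt_top F₀ (k := max k₀ k₁) (lt_of_le_of_lt ?_ ENNReal.one_lt_top)
  -- A finite partial sum involves finitely many levels, so a single `n` has `ε n` small enough for
  -- all of them. The bound `1` does not depend on that `n`.
  rw [entropyTail_eq_tsum, ENNReal.tsum_eq_iSup_sum]
  refine iSup_le fun s => ?_
  have hsmall : ∀ᶠ n in atTop, ∀ j ∈ s, 2 * ε n ≤ (1 / 2 : ℝ) ^ (j + max k₀ k₁ + 1) := by
    refine (Finset.eventually_all _).2 fun j _ => ?_
    have h2 : Tendsto (fun n => 2 * ε n) atTop (𝓝 0) := by simpa using hε.const_mul 2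
    exact h2.eventually_le_const (by positivity)
  obtain ⟨n, hn1, ⟨c⟩, hn3⟩ := (hev.and (hc.and hsmall)).exists
  calc ∑ j ∈ s, entropyTerm F₀ ((1 + α) / 2) (j + max k₀ k₁)
      ≤ ∑ j ∈ s, entropyTerm (F n) α (j + (max k₀ k₁ + 1)) := by
        refine Finset.sum_le_sum fun j hj => c.entropyTerm_le (hn3 j hj) ?_
        have h1 : (k₁ : ℝ) ≤ ((j + max k₀ k₁ : ℕ) : ℝ) := by
          exact_mod_cast (le_max_right k₀ k₁).trans (Nat.le_add_left _ _)
        have h2 := (div_le_iff₀ (by linarith)).1 (hk₁.trans h1)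
        linarith
    _ ≤ entropyTail (F n) α (max k₀ k₁ + 1) := by
        rw [entropyTail_eq_tsum]
        exact ENNReal.sum_le_tsum _
    _ ≤ entropyTail (F n) α k₀ :=
        entropyTail_antitone _ _ ((le_max_left _ _).trans (Nat.le_succ _))
    _ ≤ 1 := hn1.le

/-! ### Convergence of covariances -/

namespace IsCentredGaussian

variable {F : Type u} [MetricSpace F] {Ω : Type v} [MeasurableSpace Ω] {P : Measure Ω}
  [IsProbabilityMeasure P] {G : F → Ω → ℝ}

omit [IsProbabilityMeasure P] in
theorem covFn_self (hG : IsCentredGaussian G P) (x : F) : covFn G P x x = Var[G x; P] :=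
  covariance_self (hG.memLp x).aestronglyMeasurable.aemeasurable

theorem covFn_polarization (hG : IsCentredGaussian G P) (x y : F) :
    covFn G P x y = (covFn G P x x + covFn G P y y - dist x y ^ 2) / 2 := by
  have h := ProbabilityTheory.variance_fun_sub (hG.memLp x) (hG.memLp y)
  rw [hG.variance_sub] at h
  rw [hG.covFn_self, hG.covFn_self, covFn]
  linarith

/-- With variances `A`, `B`, covariance `C` and distance `d`, one has `A + B = 2C + d²` and `AB ≥
C²`, so `(A - B)² ≤ d²(4C + d²)`. The bound uses only `C` and `d`, so no prior bound on the
variances is required. -/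
theorem abs_covFn_self_sub_le (hG : IsCentredGaussian G P) (x y : F) :
    |covFn G P x x - (covFn G P x y + dist x y ^ 2 / 2)| ≤
      dist x y * Real.sqrt (4 * covFn G P x y + dist x y ^ 2) / 2 := by
  have hsq : covFn G P x y ^ 2 ≤ covFn G P x x * covFn G P y y := by
    -- This is the variance of `G x + t * G y`; its nonnegative quadratic has nonpositive
    -- discriminant.
    have h : ∀ t : ℝ, 0 ≤ covFn G P y y * (t * t) + 2 * covFn G P x y * t + covFn G P x x := by
      intro t
      have hv := ProbabilityTheory.variance_add (hG.memLp x) ((hG.memLp y).const_mul t)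
      rw [variance_const_mul, covariance_const_mul_right, ← hG.covFn_self, ← hG.covFn_self] at hv
      have := variance_nonneg (G x + fun ω => t * G y ω) P
      rw [hv] at this
      change 0 ≤ _ + 2 * (t * covFn G P x y) + _ at this
      linarith
    have := discrim_le_zero h
    rw [discrim] at this
    linarith
  have hpol := hG.covFn_polarization x y
  set A := covFn G P x x
  set B := covFn G P y y
  set C := covFn G P x y
  set d := dist x y
  have hAB : A + B = 2 * C + d ^ 2 := by linarith
  have habs : |A - B| ≤ d * Real.sqrt (4 * C + d ^ 2) := by
    rw [← Real.sqrt_sq (show 0 ≤ d from dist_nonneg), ← Real.sqrt_mul (sq_nonneg d),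
      Real.sqrt_sq (show 0 ≤ d from dist_nonneg)]
    refine Real.abs_le_sqrt ?_
    have : (A - B) ^ 2 = (A + B) ^ 2 - 4 * (A * B) := by ring
    rw [this, hAB]
    nlinarith
  have : A - (C + d ^ 2 / 2) = (A - B) / 2 := by linarith
  rw [this, abs_div, abs_two]
  linarith

end IsCentredGaussian

theorem tendsto_covFn_self {F : ℕ → Type u} [∀ n, MetricSpace (F n)]
    {Ω : ℕ → Type v} [∀ n, MeasurableSpace (Ω n)] {P : ∀ n, Measure (Ω n)}
    [∀ n, IsProbabilityMeasure (P n)] {G : ∀ n, F n → Ω n → ℝ}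
    (hG : ∀ n, IsCentredGaussian (G n) (P n)) {x y : ∀ n, F n} {s : ℝ}
    (hd : Tendsto (fun n => dist (x n) (y n)) atTop (𝓝 0))
    (hs : Tendsto (fun n => covFn (G n) (P n) (x n) (y n)) atTop (𝓝 s)) :
    Tendsto (fun n => covFn (G n) (P n) (x n) (x n)) atTop (𝓝 s) := by
  have h1 : Tendsto (fun n => covFn (G n) (P n) (x n) (y n) + dist (x n) (y n) ^ 2 / 2) atTop
      (𝓝 s) := by simpa using hs.add ((hd.pow 2).div_const 2)
  have h2 : Tendsto (fun n => dist (x n) (y n) *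
      Real.sqrt (4 * covFn (G n) (P n) (x n) (y n) + dist (x n) (y n) ^ 2) / 2) atTop (𝓝 0) := by
    simpa using (hd.mul ((hs.const_mul 4).add (hd.pow 2)).sqrt).div_const 2
  have h3 := squeeze_zero_norm (fun n => (Real.norm_eq_abs _).trans_le <| (hG n).abs_covFn_self_sub_le (x n) (y n)) h2
  simpa using h3.add h1

theorem tendsto_covFn_toLeft {F : ℕ → Type u} [∀ n, MetricSpace (F n)]
    {Ω : ℕ → Type v} [∀ n, MeasurableSpace (Ω n)] {P : ∀ n, Measure (Ω n)}
    [∀ n, IsProbabilityMeasure (P n)] {G : ∀ n, F n → Ω n → ℝ}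
    (hG : ∀ n, IsCentredGaussian (G n) (P n)) {F₀ : Type u} [MetricSpace F₀]
    {Ω₀ : Type w} [MeasurableSpace Ω₀] {P₀ : Measure Ω₀} [IsProbabilityMeasure P₀]
    {G₀ : F₀ → Ω₀ → ℝ} (hG₀ : IsCentredGaussian G₀ P₀) {ε : ℕ → ℝ} (hε : Tendsto ε atTop (𝓝 0))
    {q : ∀ n, F₀ → F n}
    (hq : ∀ᶠ n in atTop, ∃ c : CovCoupling (covFn (G n) (P n)) (covFn G₀ P₀) (ε n),
      c.toLeft = q n) (y y' : F₀) :
    Tendsto (fun n => covFn (G n) (P n) (q n y) (q n y')) atTop (𝓝 (covFn G₀ P₀ y y')) := by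
  have h2ε : Tendsto (fun n => 2 * ε n) atTop (𝓝 0) := by simpa using hε.const_mul 2
  have hself : ∀ y, Tendsto (fun n => covFn (G n) (P n) (q n y) (q n y)) atTop
      (𝓝 (covFn G₀ P₀ y y)) := by
    intro y
    -- The coupling exists only for large `n`; the implication lets the second point `z` be chosen
    -- for every `n`.
    have hex : ∀ n, ∃ z : F n, (∃ c : CovCoupling (covFn (G n) (P n)) (covFn G₀ P₀) (ε n),
        c.toLeft = q n) → dist (q n y) z ≤ 2 * ε n ∧
          |covFn (G n) (P n) (q n y) z - covFn G₀ P₀ y y| ≤ ε n := by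
      intro n
      by_cases h : ∃ c : CovCoupling (covFn (G n) (P n)) (covFn G₀ P₀) (ε n), c.toLeft = q n
      · obtain ⟨c, hc⟩ := h
        exact ⟨c.toLeft' y, fun _ => hc ▸ ⟨c.dist_toLeft_toLeft'_le y, c.abs_sub_le y⟩⟩
      · exact ⟨q n y, fun h' => absurd h' h⟩
    choose z hz using hex
    refine tendsto_covFn_self hG (y := z) ?_ ?_
    · exact squeeze_zero' (Eventually.of_forall fun _ => dist_nonneg)
        (hq.mono fun n hn => (hz n hn).1) h2ε
    · rw [tendsto_iff_dist_tendsto_zero]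
      exact squeeze_zero' (Eventually.of_forall fun _ => dist_nonneg)
        (hq.mono fun n hn => (hz n hn).2) hε
  have hdist : Tendsto (fun n => dist (q n y) (q n y')) atTop (𝓝 (dist y y')) := by
    rw [tendsto_iff_dist_tendsto_zero]
    refine squeeze_zero' (Eventually.of_forall fun _ => dist_nonneg) (hq.mono ?_) h2ε
    rintro n ⟨c, hc⟩
    exact hc ▸ c.abs_dist_toLeft_sub_le y y'
  rw [hG₀.covFn_polarization]
  exact ((((hself y).add (hself y')).sub (hdist.pow 2)).div_const 2).congr
    fun n => ((hG n).covFn_polarization (q n y) (q n y')).symm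

/-! ### Approximation by finite marginals -/

/-- A net point `b` is matched with every `x` within `ε + 2⁻ᵏ` of it in the common space. Then
`toLeft b` and `x` are within `2ε + 2⁻ᵏ ≤ 2 * 2⁻ᵏ`, so only the modulus of continuity of `g` is
needed. -/
theorem CovCoupling.dist_pathTriple_le {F₁ F₂ : Type u} [MetricSpace F₁] [CompactSpace F₁]
    [Nonempty F₁] [MetricSpace F₂] {S₁ : F₁ → F₁ → ℝ} {S₂ : F₂ → F₂ → ℝ} {ε : ℝ}
    (c : CovCoupling S₁ S₂ ε) {B : Finset F₂} [Nonempty B] {k : ℕ}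
    (hB : ∀ y, ∃ b ∈ B, dist y b ≤ (1 / 2 : ℝ) ^ k) (hε : 2 * ε ≤ (1 / 2 : ℝ) ^ k) {g : F₁ → ℝ}
    (hg : Continuous g) {r : ℝ} (hr : 2 * (1 / 2 : ℝ) ^ k ≤ r)
    (h : ∀ x y, dist x y ≤ 2 * (1 / 2 : ℝ) ^ k → |g x - g y| ≤ r) :
    dist (pathTriple B fun b => g (c.toLeft b)) (pathTriple F₁ g) ≤ r := by
  have hk : (0 : ℝ) < (1 / 2 : ℝ) ^ k := by positivity
  refine GaussConv.dist_pathTriple_le continuous_of_discreteTopology hg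
    (f₁ := fun b : B => c.inr b) (f₂ := c.inl) (c.isometry_inr.comp isometry_subtype_coe)
    c.isometry_inl (C := {p | dist (c.inr p.1) (c.inl p.2) ≤ ε + (1 / 2 : ℝ) ^ k})
    ⟨fun b => ⟨c.toLeft b, ?_⟩, fun x => ?_⟩ (by linarith) fun b x hbx => ⟨?_, h _ _ ?_⟩
  · have := c.dist_toLeft_le b
    rw [dist_comm] at this
    change dist _ _ ≤ _
    linarith
  · obtain ⟨b, hb, hxb⟩ := hB (c.toRight x)
    refine ⟨⟨b, hb⟩, ?_⟩
    change dist (c.inr b) (c.inl x) ≤ _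
    have h1 := c.dist_toRight_le x
    have h2 := dist_triangle (c.inl x) (c.inr (c.toRight x)) (c.inr b)
    rw [c.isometry_inr.dist_eq] at h2
    rw [dist_comm]
    linarith
  · have : dist (c.inr b) (c.inl x) ≤ ε + (1 / 2 : ℝ) ^ k := hbx
    linarith
  · have h1 : dist (c.inr b) (c.inl x) ≤ ε + (1 / 2 : ℝ) ^ k := hbx
    have h2 := c.dist_toLeft_le b
    have h3 := dist_triangle (c.inl (c.toLeft b)) (c.inr b) (c.inl x)
    rw [c.isometry_inl.dist_eq] at h3
    linarith

theorem IsCentredGaussian.measure_lt_dist_pathTriple_le {F₁ F₂ : Type u} [MetricSpace F₁]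
    [CompactSpace F₁] [Nonempty F₁] [MetricSpace F₂] {Ω : Type v} [MeasurableSpace Ω]
    {P : Measure Ω} [IsProbabilityMeasure P] {G G' : F₁ → Ω → ℝ} (hG : IsCentredGaussian G P)
    (hG' : IsContinuousVersion G G' P) {S₁ : F₁ → F₁ → ℝ} {S₂ : F₂ → F₂ → ℝ} {ε : ℝ}
    (c : CovCoupling S₁ S₂ ε) {B : Finset F₂} [Nonempty B] {k : ℕ}
    (hB : ∀ y, ∃ b ∈ B, dist y b ≤ (1 / 2 : ℝ) ^ k) (hε : 2 * ε ≤ (1 / 2 : ℝ) ^ k)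
    {α : ℝ} (hα : α < 1) {r : ℝ} (hr : 2 * (1 / 2 : ℝ) ^ k ≤ r) (hαr : 3 * tailBound α k ≤ r) :
    P {ω | r < dist (pathTriple B fun b => G' (c.toLeft b) ω) (pathTriple F₁ fun x => G' x ω)} ≤
      8 * entropyTail F₁ α k := by
  refine le_trans (measure_mono_ae ?_) (hG.measure_not_modulus_le hα hG' k)
  filter_upwards [hG'.continuous] with ω hω hlt hmod
  exact absurd (c.dist_pathTriple_le hB hε hω hr fun x y hxy => (hmod x y hxy).trans hαr)
    (not_le.2 hlt)

theorem IsContinuousVersion.isCentredGaussian {F : Type u} [MetricSpace F] {Ω : Type v}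
    [MeasurableSpace Ω] {P : Measure Ω} {G G' : F → Ω → ℝ} (h : IsContinuousVersion G G' P)
    (hG : IsCentredGaussian G P) : IsCentredGaussian G' P where
  gaussian := hG.gaussian.congr fun x => (h.version x).symm
  centred x := by rw [integral_congr_ae (h.version x), hG.centred]
  dist_eq x y := by
    rw [hG.dist_eq]
    congr 1
    refine integral_congr_ae ?_
    filter_upwards [h.version x, h.version y] with ω hx hy
    rw [hx, hy]

theorem IsContinuousVersion.covFn_eq {F : Type u} [MetricSpace F] {Ω : Type v}
    [MeasurableSpace Ω] {P : Measure Ω} {G G' : F → Ω → ℝ} (h : IsContinuousVersion G G' P) :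
    covFn G' P = covFn G P := by
  funext x y
  have hx := integral_congr_ae (h.version x)
  have hy := integral_congr_ae (h.version y)
  rw [covFn, covFn, covariance, covariance, hx, hy]
  refine integral_congr_ae ?_
  filter_upwards [h.version x, h.version y] with ω h1 h2
  rw [h1, h2]

theorem tendstoInDistribution_pathTriple {F : ℕ → Type u} [∀ n, MetricSpace (F n)]
    [∀ n, CompactSpace (F n)] [∀ n, Nonempty (F n)] {Ω : ℕ → Type v} [∀ n, MeasurableSpace (Ω n)]
    {P : ∀ n, Measure (Ω n)} [∀ n, IsProbabilityMeasure (P n)] {G : ∀ n, F n → Ω n → ℝ}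
    (hG : ∀ n, IsCentredGaussian (G n) (P n)) {F₀ : Type u} [MetricSpace F₀] [CompactSpace F₀]
    [Nonempty F₀] {Ω₀ : Type w} [MeasurableSpace Ω₀] {P₀ : Measure Ω₀} [IsProbabilityMeasure P₀]
    {G₀ : F₀ → Ω₀ → ℝ} (hG₀ : IsCentredGaussian G₀ P₀)
    (hGc : ∀ n, ∀ᵐ ω ∂P n, Continuous fun x => G n x ω)
    (hG₀c : ∀ᵐ ω ∂P₀, Continuous fun x => G₀ x ω) {ε : ℕ → ℝ} (hε : Tendsto ε atTop (𝓝 0))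
    (hc : ∀ᶠ n in atTop, Nonempty (CovCoupling (covFn (G n) (P n)) (covFn G₀ P₀) (ε n)))
    {α : ℝ} (hα : α < 1)
    (htail : Tendsto (fun k => limsup (fun n => entropyTail (F n) α k) atTop) atTop (𝓝 0)) :
    TendstoInDistribution (fun n ω => pathTriple (F n) fun x => G n x ω) atTop
      (fun ω => pathTriple F₀ fun x => G₀ x ω) P P₀ := by
  have hex : ∀ n, ∃ q : F₀ → F n,
      Nonempty (CovCoupling (covFn (G n) (P n)) (covFn G₀ P₀) (ε n)) →
      ∃ c : CovCoupling (covFn (G n) (P n)) (covFn G₀ P₀) (ε n), c.toLeft = q := by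
    intro n
    by_cases h : Nonempty (CovCoupling (covFn (G n) (P n)) (covFn G₀ P₀) (ε n))
    · exact ⟨h.some.toLeft, fun _ => ⟨h.some, rfl⟩⟩
    · exact ⟨fun _ => Classical.arbitrary _, fun h' => absurd h' h⟩
  choose q hq using hex
  have hcq : ∀ᶠ n in atTop, ∃ c : CovCoupling (covFn (G n) (P n)) (covFn G₀ P₀) (ε n),
      c.toLeft = q n := hc.mono hq
  obtain ⟨B, hne, hB⟩ := exists_seq_finset_net F₀
  -- `Y k n` puts the values of `G n` at the points `q n b` on `B k` with the metric of `F₀`. The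
  -- underlying space is thus the same for all `n`, and only the random vector varies.
  refine tendstoInDistribution_of_approx (Y := fun k n ω => pathTriple (B k) fun b => G n (q n b) ω)
    (Z := fun k ω => pathTriple (B k) fun b => G₀ b ω)
    (fun n => aemeasurable_pathTriple
      (fun x => ((hG n).memLp x).aestronglyMeasurable.aemeasurable) (hGc n))
    (aemeasurable_pathTriple (fun x => (hG₀.memLp x).aestronglyMeasurable.aemeasurable) hG₀c)
    (fun k => ?_) ?_ fun r hr => ?_
  · have h := tendstoInDistribution_gaussian (ι := B k) (X := fun n b => G n (q n b))
      (X₀ := fun b => G₀ b) (P := P) (P₀ := P₀)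
      (fun n => (hG n).gaussian.comp_right fun b : B k => q n b)
      (hG₀.gaussian.comp_right fun b : B k => (b : F₀)) (fun n b => (hG n).centred _)
      (fun b => hG₀.centred _) fun b b' => tendsto_covFn_toLeft hG hG₀ hε hcq b b'
    exact h.continuous_comp (continuous_pathTriple_of_finite (B k))
  · filter_upwards [hG₀c] with ω hω
    exact tendsto_pathTriple_net hω (fun k => by positivity)
      (tendsto_pow_atTop_nhds_zero_of_lt_one (by norm_num) (by norm_num)) hB
  · have h1 : Tendsto (fun k : ℕ => 2 * (1 / 2 : ℝ) ^ k) atTop (𝓝 0) := by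
      simpa using (tendsto_pow_atTop_nhds_zero_of_lt_one (r := (1 / 2 : ℝ))
        (by norm_num) (by norm_num)).const_mul 2
    have h2 : Tendsto (fun k => 3 * tailBound α k) atTop (𝓝 0) := by
      simpa using (tendsto_tailBound α).const_mul 3
    -- The factor `8` of the chaining estimate is compensated here.
    have hr8 : (0 : ℝ≥0∞) < ENNReal.ofReal (r / 8) := ENNReal.ofReal_pos.2 (by positivity)
    filter_upwards [htail.eventually_lt_const hr8, h1.eventually_le_const hr,
      h2.eventually_le_const hr] with k hk1 hk2 hk3
    have h3 : Tendsto (fun n => 2 * ε n) atTop (𝓝 0) := by simpa using hε.const_mul 2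
    filter_upwards [eventually_lt_of_limsup_lt hk1, hcq,
      h3.eventually_le_const (show (0 : ℝ) < (1 / 2 : ℝ) ^ k by positivity)] with n hn1 ⟨c, hn2⟩ hn3
    rw [← hn2]
    refine ENNReal.toReal_le_of_le_ofReal hr.le (((hG n).measure_lt_dist_pathTriple_le
      ⟨fun _ => ae_eq_rfl, hGc n⟩ c (hB k) hn3 hα hk2 hk3).trans ?_)
    refine (mul_le_mul_right hn1.le 8).trans_eq ?_
    rw [← ENNReal.ofReal_ofNat 8, ← ENNReal.ofReal_mul (by norm_num)]
    congr 1
    ring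

theorem exists_tendsto_eventually_covCoupling {F : ℕ → Type u} [∀ n, MetricSpace (F n)]
    {F₀ : Type u} [MetricSpace F₀] {S : ∀ n, F n → F n → ℝ} {S₀ : F₀ → F₀ → ℝ}
    (h : Tendsto (fun n => covEDist (S n) S₀) atTop (𝓝 0)) :
    ∃ ε : ℕ → ℝ, Tendsto ε atTop (𝓝 0) ∧
      ∀ᶠ n in atTop, Nonempty (CovCoupling (S n) S₀ (ε n)) := by
  -- The summand `1 / (n + 1)` makes the inequality strict, so that the infimum defining `covEDist`
  -- is beaten by an actual coupling.
  refine ⟨fun n => (covEDist (S n) S₀).toReal + 1 / ((n : ℝ) + 1), ?_, ?_⟩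
  · simpa using ((ENNReal.tendsto_toReal ENNReal.zero_ne_top).comp h).add
      tendsto_one_div_add_atTop_nhds_zero_nat
  · filter_upwards [h.eventually_lt_const ENNReal.zero_lt_top] with n hn
    have hpos : (0 : ℝ) < 1 / ((n : ℝ) + 1) := Nat.one_div_pos_of_nat
    refine nonempty_covCoupling (by positivity) ?_
    rw [ENNReal.lt_ofReal_iff_toReal_lt hn.ne]
    linarith

end GaussConv

theorem mainTheorem9
    {F : ℕ → Type u} [∀ n, MetricSpace (F n)] [∀ n, CompactSpace (F n)] [∀ n, Nonempty (F n)]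
    {Ω : ℕ → Type v} [∀ n, MeasurableSpace (Ω n)]
    (P : ∀ n, Measure (Ω n)) [∀ n, IsProbabilityMeasure (P n)]
    (G : ∀ n, F n → Ω n → ℝ) (hG : ∀ n, GaussConv.IsCentredGaussian (G n) (P n))
    (hGsum : ∀ n, GaussConv.EntropySummable (F n))
    {F₀ : Type u} [MetricSpace F₀] [CompactSpace F₀] [Nonempty F₀]
    {Ω₀ : Type w} [MeasurableSpace Ω₀] (P₀ : Measure Ω₀) [IsProbabilityMeasure P₀]
    (G₀ : F₀ → Ω₀ → ℝ) (hG₀ : GaussConv.IsCentredGaussian G₀ P₀)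
    (hcov : Tendsto
      (fun n => GaussConv.covEDist (GaussConv.covFn (G n) (P n)) (GaussConv.covFn G₀ P₀))
      atTop (𝓝 0))
    (hentropy : ∃ α ∈ Set.Ioo (0 : ℝ) 1,
      Tendsto (fun k => limsup (fun n => GaussConv.entropyTail (F n) α k) atTop) atTop (𝓝 0)) :
    GaussConv.EntropySummable F₀ ∧
    (∀ n, ∃ G' : F n → Ω n → ℝ, GaussConv.IsContinuousVersion (G n) G' (P n)) ∧
    (∃ G' : F₀ → Ω₀ → ℝ, GaussConv.IsContinuousVersion G₀ G' P₀) ∧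
    ∀ (G' : ∀ n, F n → Ω n → ℝ) (G₀' : F₀ → Ω₀ → ℝ),
      (∀ n, GaussConv.IsContinuousVersion (G n) (G' n) (P n)) →
      GaussConv.IsContinuousVersion G₀ G₀' P₀ →
      TendstoInDistribution
        (fun n ω => GaussConv.pathTriple (F n) fun x => G' n x ω) atTop
        (fun ω => GaussConv.pathTriple F₀ fun x => G₀' x ω) P P₀ := by
  obtain ⟨α, hα, htail⟩ := hentropy
  obtain ⟨ε, hε, hc⟩ := GaussConv.exists_tendsto_eventually_covCoupling hcov
  have hsum : GaussConv.EntropySummable F₀ :=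
    GaussConv.entropySummable_of_covCoupling hε hc hα htail
  refine ⟨hsum, fun n => (hG n).exists_continuousVersion (hGsum n),
    hG₀.exists_continuousVersion hsum, fun G' G₀' hG' hG₀' => ?_⟩
  refine GaussConv.tendstoInDistribution_pathTriple (fun n => (hG' n).isCentredGaussian (hG n))
    (hG₀'.isCentredGaussian hG₀) (fun n => (hG' n).continuous) hG₀'.continuous hε ?_ hα.2 htail
  filter_upwards [hc] with n hn
  rw [(hG' n).covFn_eq, hG₀'.covFn_eq]
  exact hn
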